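/- Let $M$ be a smooth, connected (Hausdorff) four-dimensional manifold, and let $g_{ab}$ and $\bar g_{ab}$ be two smooth semi-Riemannian metrics on $M$ of Lorentz signature $(1,3)$; that is, at each point the tangent space has a basis that is orthogonal for the metric and whose members have squares $+1,-1,-1,-1$. A \emph{curve} is a smooth map $\gamma : I \to M$, where $I \subseteq \mathbb{R}$ is a (possibly unbounded, not necessarily open) interval with more than one point; if $I$ is not open, smoothness means that $\gamma$ is the restriction to $I$ of a smooth map defined on an open interval containing $I$, and smoothness of real-valued maps on $I$ is understood likewise. Relative to a metric, a tangent vector $\eta^a$ is \emph{timelike} if $\eta^a\eta_a > 0$ and \emph{null} if $\eta^a\eta_a = 0$, and a curve is timelike (null) if all its tangent vectors are. A curve with tangent field $\xi^a$ is a \emph{geodesic} of a metric if $\xi^n\nabla_n\xi^a = 0$, where $\nabla_a$ is the unique torsion-free derivative operator compatible with that metric. A curve $\gamma_2 : I_2 \to M$ is a \emph{reparametrization} of a curve $\gamma_1 : I_1 \to M$ if $\gamma_2 = \gamma_1\circ\tau$ for some smooth map $\tau$ of $I_2$ onto $I_1$ with everywhere positive derivative. Then the following conditions are equivalent. (1)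 $\bar g_{ab}$ and $g_{ab}$ agree as to which curves on $M$ are timelike. (2) $\bar g_{ab}$ and $g_{ab}$ agree as to which curves on $M$ can be reparametrized so as to be null geodesics. (3) $\bar g_{ab}$ and $g_{ab}$ are conformally equivalent, i.e. there is a smooth map $\Omega : M \to \mathbb{R}$ such that $\bar g_{ab} = \Omega^2 g_{ab}$. -/

import Mathlib

open Set Bundle
open scoped Manifold ContDiff

noncomputable section

/-- The model space `ℝ⁴` of a four-dimensional manifold. -/
abbrev R4 : Type := EuclideanSpace ℝ (Fin 4)

section Definitions

variable {M : Type*} [TopologicalSpace M] [ChartedSpace R4 M]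

/-- A smooth semi-Riemannian metric of Lorentz signature `(1, 3)` on the four-dimensional smooth
manifold `M`: a smooth field of symmetric bilinear forms on the tangent spaces such that every
tangent space has a basis that is orthonormal with squares `+1, -1, -1, -1`. -/
structure LorentzMetric (M : Type*) [TopologicalSpace M] [ChartedSpace R4 M]
    [IsManifold (𝓡 4) ∞ M] where
  /-- The bilinear form `g_{ab}` at each point. -/
  form (p : M) : TangentSpace (𝓡 4) p →L[ℝ] TangentSpace (𝓡 4) p →L[ℝ] ℝ
  symm (p : M) (u v : TangentSpace (𝓡 4) p) : form p u v = form p v u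
  signature (p : M) : ∃ ξ : Module.Basis (Fin 4) ℝ (TangentSpace (𝓡 4) p),
    ∀ i j, form p (ξ i) (ξ j) = if i = j then (if i = 0 then 1 else -1) else 0
  smooth : ContMDiff (𝓡 4) ((𝓡 4).prod 𝓘(ℝ, R4 →L[ℝ] R4 →L[ℝ] ℝ)) ∞
    (fun p ↦ TotalSpace.mk' (R4 →L[ℝ] R4 →L[ℝ] ℝ)
      (E := fun p : M ↦ TangentSpace (𝓡 4) p →L[ℝ] TangentSpace (𝓡 4) p →L[ℝ] ℝ) p (form p))

/-- `S` is a (bounded or unbounded, open, half-open or closed) interval of `ℝ` with more than one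
point. -/
def IsInterval (S : Set ℝ) : Prop := S.OrdConnected ∧ S.Nontrivial

/-- Smoothness of a map defined on a not necessarily open interval `S ⊆ ℝ`: the map is the
restriction to `S` of a smooth map defined on an open interval. The values of `f` outside `S` are
irrelevant. -/
def SmoothOnInterval (F : Type*) [NormedAddCommGroup F] [NormedSpace ℝ F]
    {N : Type*} [TopologicalSpace N] [ChartedSpace F N] (S : Set ℝ) (f : ℝ → N) : Prop :=
  ∃ J : Set ℝ, IsOpen J ∧ J.OrdConnected ∧ S ⊆ J ∧
    ∃ F' : ℝ → N, ContMDiffOn 𝓘(ℝ, ℝ) 𝓘(ℝ, F) ∞ F' J ∧ EqOn F' f S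

/-- A curve in `M`: a smooth map from an interval `S` to `M` (given by a map on `ℝ` of which only
the values on `S` matter). -/
def IsCurve (S : Set ℝ) (γ : ℝ → M) : Prop := IsInterval S ∧ SmoothOnInterval R4 S γ

/-- The tangent vector at `γ s` of the curve `γ` with domain `S` (one-sided at an end point). -/
def tangentVector (S : Set ℝ) (γ : ℝ → M) (s : ℝ) : TangentSpace (𝓡 4) (γ s) :=
  mfderivWithin 𝓘(ℝ, ℝ) (𝓡 4) γ S s (1 : ℝ)

/-- The curve `γ₂` with domain `S₂` is an orientation preserving reparametrization of the curve
`γ₁` with domain `S₁`: `γ₂ = γ₁ ∘ τ` for a smooth map `τ` of `S₂` onto `S₁` with everywhere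
positive derivative. -/
def IsReparametrization (S₂ : Set ℝ) (γ₂ : ℝ → M) (S₁ : Set ℝ) (γ₁ : ℝ → M) : Prop :=
  ∃ τ : ℝ → ℝ, SmoothOnInterval ℝ S₂ τ ∧ τ '' S₂ = S₁ ∧
    (∀ s ∈ S₂, 0 < derivWithin τ S₂ s) ∧ ∀ s ∈ S₂, γ₂ s = γ₁ (τ s)

namespace LorentzMetric

variable [IsManifold (𝓡 4) ∞ M] (g : LorentzMetric M)

/-- The curve `γ` with domain `S` is timelike: all its tangent vectors are timelike. -/
def IsTimelike (S : Set ℝ) (γ : ℝ → M) : Prop :=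
  ∀ s ∈ S, 0 < g.form (γ s) (tangentVector S γ s) (tangentVector S γ s)

/-- The curve `γ` with domain `S` is null: all its tangent vectors are null. -/
def IsNull (S : Set ℝ) (γ : ℝ → M) : Prop :=
  ∀ s ∈ S, g.form (γ s) (tangentVector S γ s) (tangentVector S γ s) = 0

/-- The `i`-th coordinate vector of the chart `φ` at the point with coordinates `y`. -/
def coordVector (φ : OpenPartialHomeomorph M R4) (y : R4) (i : Fin 4) :
    TangentSpace (𝓡 4) (φ.symm y) :=
  mfderiv (𝓡 4) (𝓡 4) φ.symm y (EuclideanSpace.single i (1 : ℝ))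

/-- The matrix `g_{ij}` of the metric in the chart `φ`, as a function of the coordinates. -/
def components (φ : OpenPartialHomeomorph M R4) (y : R4) : Matrix (Fin 4) (Fin 4) ℝ :=
  Matrix.of fun i j ↦ g.form (φ.symm y) (coordVector φ y i) (coordVector φ y j)

/-- The partial derivative `∂_k g_{ij}` in the chart `φ`. -/
def partialComponents (φ : OpenPartialHomeomorph M R4) (y : R4) (k i j : Fin 4) : ℝ :=
  fderiv ℝ (fun z ↦ g.components φ z i j) y (EuclideanSpace.single k (1 : ℝ))

/-- The coefficients `Γ^k_{ij} = ½ g^{kl} (∂_i g_{jl} + ∂_j g_{il} - ∂_l g_{ij})` in the chart `φ`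
of the derivative operator determined by the metric, i.e. of the unique torsion-free derivative
operator compatible with it. -/
def christoffel (φ : OpenPartialHomeomorph M R4) (y : R4) (k i j : Fin 4) : ℝ :=
  1 / 2 * ∑ l, (g.components φ y)⁻¹ k l *
    (g.partialComponents φ y i j l + g.partialComponents φ y j i l - g.partialComponents φ y l i j)

/-- The components in the chart `φ` of the acceleration `ξⁿ ∇ₙ ξᵃ` at the parameter `s` of the curve
`γ` with domain `S`, where `ξᵃ` is its tangent field. -/
def acceleration (φ : OpenPartialHomeomorph M R4) (S : Set ℝ) (γ : ℝ → M) (s : ℝ)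
    (k : Fin 4) : ℝ :=
  derivWithin (derivWithin (fun t ↦ φ (γ t)) S) S s k +
    ∑ i, ∑ j, g.christoffel φ (φ (γ s)) k i j *
      derivWithin (fun t ↦ φ (γ t)) S s i * derivWithin (fun t ↦ φ (γ t)) S s j

/-- The curve `γ` with domain `S` is a geodesic: its acceleration vanishes everywhere, in every
smooth chart. -/
def IsGeodesic (S : Set ℝ) (γ : ℝ → M) : Prop :=
  ∀ s ∈ S, ∀ φ ∈ IsManifold.maximalAtlas (𝓡 4) ∞ M, γ s ∈ φ.source →
    ∀ k, g.acceleration φ S γ s k = 0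

/-- The curve `γ` with domain `S` can be reparametrized so as to be a null geodesic. -/
def IsNullGeodesicUpToReparametrization (S : Set ℝ) (γ : ℝ → M) : Prop :=
  ∃ (S' : Set ℝ) (γ' : ℝ → M), IsCurve S' γ' ∧ IsReparametrization S' γ' S γ ∧
    g.IsNull S' γ' ∧ g.IsGeodesic S' γ'

/-- `h` is conformally equivalent to `g`: `h = Ω² g` for some smooth `Ω : M → ℝ`. -/
def IsConformallyEquivalent (h g : LorentzMetric M) : Prop :=
  ∃ Ω : M → ℝ, ContMDiff (𝓡 4) 𝓘(ℝ, ℝ) ∞ Ω ∧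
    ∀ (p : M) (u v : TangentSpace (𝓡 4) p), h.form p u v = Ω p ^ 2 * g.form p u v

end LorentzMetric

end Definitions

end

open Set Bundle
open scoped Manifold ContDiff

noncomputable section

/-! ### Linear algebra of Lorentz forms on one tangent space. -/

section LorentzAlgebra

variable {V : Type*} [AddCommGroup V] [Module ℝ V] [TopologicalSpace V]

/-! A Lorentz form is determined up to a factor by its null cone: a symmetric form vanishing on that
cone is a multiple of it (`IsLorentzBasis.eq_mul_of_null`), and equal signatures make the factor
positive. Both curve conditions yield this pointwise inclusion of null cones. Every timelike vector
is tangent to a timelike curve, and null vectors are limits of timelike ones; every null vector is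
the initial velocity of a null geodesic, and reparametrization only rescales it. Smoothness of the
factor is local: it is a quotient of smooth functions.

Conversely, timelike vectors are plainly shared by conformal metrics. For null geodesics, write the
geodesic equation with lowered index, as the Euler-Lagrange expression `lowAcc` of the energy.
Replacing g by μg adds a term proportional to g(v, ·) and one proportional to g(v, v)
(`lowAcc_smul`). The second vanishes on null curves; the first is an acceleration parallel to the
velocity and is removed by a new parameter, the solution of σ' = Ω² along the curve. -/

/-- A basis is orthonormal with squares `+1, -1, -1, -1` for the bilinear form `B`. -/
def IsLorentzBasis (B : V →L[ℝ] V →L[ℝ] ℝ) (ξ : Module.Basis (Fin 4) ℝ V) : Prop :=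
  ∀ i j, B (ξ i) (ξ j) = if i = j then (if i = 0 then 1 else -1) else 0

lemma bilin_apply_eq_sum_basis {ι : Type*} [Fintype ι] (ξ : Module.Basis ι ℝ V)
    (B : V →L[ℝ] V →L[ℝ] ℝ) (u v : V) :
    B u v = ∑ i, ∑ j, ξ.repr u i * ξ.repr v j * B (ξ i) (ξ j) := by
  have h (w : V) : B w v = ∑ j, ξ.repr v j * B w (ξ j) := by
    conv_lhs => rw [← ξ.sum_repr v, map_sum]
    simp only [map_smul, smul_eq_mul]
  conv_lhs => rw [← ξ.sum_repr u, map_sum, sum_apply]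
  refine Finset.sum_congr rfl fun i _ ↦ ?_
  rw [map_smul, smul_apply, h, smul_eq_mul, Finset.mul_sum]
  exact Finset.sum_congr rfl fun j _ ↦ (mul_assoc _ _ _).symm

lemma IsLorentzBasis.apply_self {B : V →L[ℝ] V →L[ℝ] ℝ} {ξ : Module.Basis (Fin 4) ℝ V}
    (hξ : IsLorentzBasis B ξ) (v : V) :
    B v v = ξ.repr v 0 ^ 2 - ξ.repr v 1 ^ 2 - ξ.repr v 2 ^ 2 - ξ.repr v 3 ^ 2 := by
  have h (i j : Fin 4) := hξ i j
  rw [bilin_apply_eq_sum_basis ξ]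
  simp only [h, Fin.sum_univ_four]
  simp
  ring

/-- A symmetric form vanishing on the null vectors of a Lorentz form is a multiple of it. -/
lemma IsLorentzBasis.eq_mul_of_null {B C : V →L[ℝ] V →L[ℝ] ℝ} {ξ : Module.Basis (Fin 4) ℝ V}
    (hξ : IsLorentzBasis B ξ) (hC : ∀ u v, C u v = C v u)
    (hnull : ∀ v, B v v = 0 → C v v = 0) (u v : V) :
    C u v = C (ξ 0) (ξ 0) * B u v := by
  have h (i j : Fin 4) := hξ i j
  -- The vectors ξ₀ + aξ₁ + bξ₂ + cξ₃ over the unit sphere are null, and each gives one linear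
  -- relation among the ten coefficients of `C`.
  have key (a b c : ℝ) (habc : a ^ 2 + b ^ 2 + c ^ 2 = 1) :
      C (ξ 0) (ξ 0) + a ^ 2 * C (ξ 1) (ξ 1) + b ^ 2 * C (ξ 2) (ξ 2) + c ^ 2 * C (ξ 3) (ξ 3)
        + 2 * a * C (ξ 0) (ξ 1) + 2 * b * C (ξ 0) (ξ 2) + 2 * c * C (ξ 0) (ξ 3)
        + 2 * a * b * C (ξ 1) (ξ 2) + 2 * a * c * C (ξ 1) (ξ 3) + 2 * b * c * C (ξ 2) (ξ 3)
        = 0 := by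
    have := hnull (ξ 0 + a • ξ 1 + b • ξ 2 + c • ξ 3) (by
      simp [h]
      linear_combination -habc)
    simp only [map_add, map_smul, add_apply, smul_apply,
      smul_eq_mul, hC (ξ 1) (ξ 0), hC (ξ 2) (ξ 0), hC (ξ 3) (ξ 0), hC (ξ 2) (ξ 1),
      hC (ξ 3) (ξ 1), hC (ξ 3) (ξ 2)] at this
    linear_combination this
  -- Opposite directions separate the time-space coefficients from the diagonal ones; the 3-4-5
  -- triples are rational unit vectors that isolate the mixed spatial coefficients.
  have e1 := key 1 0 0 (by norm_num)
  have e1' := key (-1) 0 0 (by norm_num)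
  have e2 := key 0 1 0 (by norm_num)
  have e2' := key 0 (-1) 0 (by norm_num)
  have e3 := key 0 0 1 (by norm_num)
  have e3' := key 0 0 (-1) (by norm_num)
  have e12 := key (3 / 5) (4 / 5) 0 (by norm_num)
  have e13 := key (3 / 5) 0 (4 / 5) (by norm_num)
  have e23 := key 0 (3 / 5) (4 / 5) (by norm_num)
  have hbasis (i j : Fin 4) : C (ξ i) (ξ j) = C (ξ 0) (ξ 0) * B (ξ i) (ξ j) := by
    rw [h]
    fin_cases i <;> fin_cases j <;>
      simp [hC (ξ 1) (ξ 0), hC (ξ 2) (ξ 0), hC (ξ 3) (ξ 0), hC (ξ 2) (ξ 1),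
        hC (ξ 3) (ξ 1), hC (ξ 3) (ξ 2)] <;> linarith
  rw [bilin_apply_eq_sum_basis ξ C, bilin_apply_eq_sum_basis ξ B, Finset.mul_sum]
  refine Finset.sum_congr rfl fun i _ ↦ ?_
  rw [Finset.mul_sum]
  refine Finset.sum_congr rfl fun j _ ↦ ?_
  rw [hbasis]
  ring

/-- The proportionality factor of two Lorentz forms of signature `(1, 3)` is positive. -/
lemma IsLorentzBasis.factor_pos {B C : V →L[ℝ] V →L[ℝ] ℝ} {ξ η : Module.Basis (Fin 4) ℝ V}
    (hξ : IsLorentzBasis B ξ) (hη : IsLorentzBasis C η) {c : ℝ}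
    (h : ∀ u v, C u v = c * B u v) : 0 < c := by
  by_contra! hc
  have hB1 : c * B (η 1) (η 1) = -1 := by rw [← h, hη]; simp
  have hB2 : c * B (η 2) (η 2) = -1 := by rw [← h, hη]; simp
  have hB12 : c * B (η 1) (η 2) = 0 := by rw [← h, hη]; simp
  have hB21 : c * B (η 2) (η 1) = 0 := by rw [← h, hη]; simp
  -- This combination of two `C`-spacelike vectors has no `ξ 0` component, so `B` is nonpositive on
  -- it; with `c ≤ 0`, `C` would be nonnegative there, although its value is -(a² + b²).
  set a := ξ.repr (η 2) 0
  set b := ξ.repr (η 1) 0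
  have hv := hξ.apply_self (a • η 1 - b • η 2)
  have h1 := hξ.apply_self (η 1)
  have h0 : ξ.repr (a • η 1 - b • η 2) 0 = 0 := by
    simp [a, b]; ring
  rw [h0] at hv
  have hle : B (a • η 1 - b • η 2) (a • η 1 - b • η 2) ≤ 0 := by
    rw [hv]
    nlinarith [sq_nonneg (ξ.repr (a • η 1 - b • η 2) 1), sq_nonneg (ξ.repr (a • η 1 - b • η 2) 2),
      sq_nonneg (ξ.repr (a • η 1 - b • η 2) 3)]
  have hexp : c * B (a • η 1 - b • η 2) (a • η 1 - b • η 2) = -(a ^ 2 + b ^ 2) := by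
    simp only [map_sub, map_smul, sub_apply, smul_apply,
      smul_eq_mul]
    linear_combination a ^ 2 * hB1 + b ^ 2 * hB2 - a * b * hB12 - a * b * hB21
  have hb : b = 0 := by nlinarith [mul_nonneg_of_nonpos_of_nonpos hc hle, sq_nonneg a, sq_nonneg b]
  have : B (η 1) (η 1) ≤ 0 := by
    rw [h1]
    nlinarith [sq_nonneg (ξ.repr (η 1) 1), sq_nonneg (ξ.repr (η 1) 2),
      sq_nonneg (ξ.repr (η 1) 3)]
  nlinarith [mul_nonneg_of_nonpos_of_nonpos hc this]

/-- If two forms have the same timelike vectors and one of them is Lorentzian, then its null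
vectors are null for the other form. -/
lemma IsLorentzBasis.null_of_timelike_iff {B C : V →L[ℝ] V →L[ℝ] ℝ}
    {ξ : Module.Basis (Fin 4) ℝ V} (hξ : IsLorentzBasis B ξ)
    (h : ∀ v, 0 < C v v ↔ 0 < B v v) (v : V) (hv : B v v = 0) : C v v = 0 := by
  refine le_antisymm (not_lt.1 fun hlt ↦ ((h v).1 hlt).ne' hv) ?_
  -- The sign `e` points along the time component of `v`, so adding a positive multiple of `e • ξ 0`
  -- makes the null vector `B`-timelike. Letting the multiple tend to 0 gives `0 ≤ C v v`.
  obtain ⟨e, he, hev⟩ : ∃ e : ℝ, e ^ 2 = 1 ∧ 0 ≤ e * ξ.repr v 0 := by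
    rcases le_total 0 (ξ.repr v 0) with h | h
    · exact ⟨1, by norm_num, by linarith⟩
    · exact ⟨-1, by norm_num, by linarith⟩
  have hpos (t : ℝ) (ht : 0 < t) : 0 < C (v + (t * e) • ξ 0) (v + (t * e) • ξ 0) := by
    rw [h, hξ.apply_self]
    rw [hξ.apply_self] at hv
    simp
    nlinarith [mul_nonneg ht.le hev, mul_pos ht ht]
  have hlim : Filter.Tendsto (fun t : ℝ ↦ C (v + (t * e) • ξ 0) (v + (t * e) • ξ 0))
      (nhdsWithin 0 (Ioi 0)) (nhds (C v v)) := by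
    have : Continuous fun t : ℝ ↦ C v v + (t * e) * (C v (ξ 0) + C (ξ 0) v)
        + (t * e) ^ 2 * C (ξ 0) (ξ 0) := by fun_prop
    have h0 := (this.tendsto 0).mono_left (nhdsWithin_le_nhds (s := Ioi 0))
    simp only [zero_mul, add_zero, ne_eq, OfNat.ofNat_ne_zero, not_false_eq_true, zero_pow] at h0
    refine h0.congr fun t ↦ ?_
    simp only [map_add, map_smul, add_apply, smul_apply,
      smul_eq_mul]
    ring
  exact ge_of_tendsto hlim (eventually_nhdsWithin_of_forall fun t ht ↦ (hpos t ht).le)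

end LorentzAlgebra

/-! ### Ordinary differential equations: smooth integral curves and parameter changes. -/

section Flows

variable {E : Type*} [NormedAddCommGroup E] [NormedSpace ℝ E]

/-- Integral curves of a smooth vector field are smooth. -/
lemma contDiffOn_of_hasDerivAt_comp {f : E → E} {U : Set E} (hf : ContDiffOn ℝ ∞ f U)
    {J : Set ℝ} (hJ : IsOpen J) {α : ℝ → E} (hmem : MapsTo α J U)
    (hα : ∀ t ∈ J, HasDerivAt α (f (α t)) t) : ContDiffOn ℝ ∞ α J := by
  rw [contDiffOn_infty]
  intro n
  induction n with
  | zero =>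
    exact contDiffOn_zero.2 fun t ht ↦ (hα t ht).continuousAt.continuousWithinAt
  | succ n ih =>
    push_cast
    rw [contDiffOn_succ_iff_deriv_of_isOpen hJ]
    refine ⟨fun t ht ↦ (hα t ht).differentiableAt.differentiableWithinAt, by simp, ?_⟩
    -- Bootstrapping: the derivative of `α` is `f ∘ α`, which is as smooth as `α` is already known
    -- to be.
    refine ((hf.of_le (by exact_mod_cast le_top)).comp ih hmem).congr fun t ht ↦ (hα t ht).deriv

/-- Local existence of smooth integral curves of a smooth vector field. -/
lemma exists_smooth_integralCurve [CompleteSpace E] {f : E → E} {U : Set E} (hU : IsOpen U)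
    (hf : ContDiffOn ℝ ∞ f U) {x₀ : E} (hx₀ : x₀ ∈ U) :
    ∃ ε > 0, ∃ α : ℝ → E, α 0 = x₀ ∧ MapsTo α (Ioo (-ε) ε) U ∧
      (∀ t ∈ Ioo (-ε) ε, HasDerivAt α (f (α t)) t) ∧ ContDiffOn ℝ ∞ α (Ioo (-ε) ε) := by
  have h1 : ContDiffAt ℝ 1 f x₀ :=
    (hf.contDiffAt (hU.mem_nhds hx₀)).of_le (by exact_mod_cast le_top)
  obtain ⟨α, hα0, ε, hε, hα⟩ :=
    h1.exists_forall_mem_closedBall_exists_eq_forall_mem_Ioo_hasDerivAt₀ 0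
  simp only [zero_sub, zero_add] at hα
  have hc : ContinuousAt α 0 := (hα 0 (by simpa using hε)).continuousAt
  obtain ⟨δ, hδ, hδU⟩ := Metric.mem_nhds_iff.1 (hc.preimage_mem_nhds (hα0 ▸ hU.mem_nhds hx₀))
  have hmem : MapsTo α (Ioo (-(min ε δ)) (min ε δ)) U := fun t ht ↦ hδU (by
    rw [Real.ball_eq_Ioo]
    exact ⟨by linarith [ht.1, min_le_right ε δ], by linarith [ht.2, min_le_right ε δ]⟩)
  have hd (t) (ht : t ∈ Ioo (-(min ε δ)) (min ε δ)) : HasDerivAt α (f (α t)) t :=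
    hα t ⟨by linarith [ht.1, min_le_left ε δ], by linarith [ht.2, min_le_left ε δ]⟩
  exact ⟨min ε δ, lt_min hε hδ, α, hα0, hmem, hd, contDiffOn_of_hasDerivAt_comp hf isOpen_Ioo hmem hd⟩

/-- Solution of the autonomous equation `σ' = m σ` on the line for positive `m`, with the whole of
the given interval as its range. -/
lemma exists_autonomous_reparam {J : Set ℝ} (hJ : IsOpen J) (hJc : J.OrdConnected)
    {m : ℝ → ℝ} (hm : ContDiffOn ℝ ∞ m J) (hpos : ∀ s ∈ J, 0 < m s) :
    ∃ (K : Set ℝ) (σ : ℝ → ℝ), IsOpen K ∧ K.OrdConnected ∧ BijOn σ K J ∧ StrictMonoOn σ K ∧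
      (∀ t ∈ K, HasDerivAt σ (m (σ t)) t) ∧ ContDiffOn ℝ ∞ σ K := by
  rcases J.eq_empty_or_nonempty with rfl | ⟨s₀, hs₀⟩
  · exact ⟨∅, id, isOpen_empty, ordConnected_empty, by simp, by simp [StrictMonoOn],
      by simp, contDiffOn_empty⟩
  have hcont : ContinuousOn (fun s ↦ (m s)⁻¹) J := hm.continuousOn.inv₀ fun s hs ↦ (hpos s hs).ne'
  -- Separation of variables: `u` is the time needed to travel from `s₀` to `s` at speed `m`, and
  -- the solution is its inverse, defined on the open interval `u '' J`.
  set u : ℝ → ℝ := fun s ↦ ∫ r in s₀..s, (m r)⁻¹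
  have hu (s) (hs : s ∈ J) : HasStrictDerivAt u (m s)⁻¹ s := by
    refine intervalIntegral.integral_hasStrictDerivAt_right ?_ ?_
      (hcont.continuousAt (hJ.mem_nhds hs))
    · exact (hcont.mono (hJc.uIcc_subset hs₀ hs)).intervalIntegrable
    · exact hcont.stronglyMeasurableAtFilter hJ s hs
  have hucont : ContinuousOn u J := fun s hs ↦ (hu s hs).hasDerivAt.continuousAt.continuousWithinAt
  have humono : StrictMonoOn u J := by
    refine strictMonoOn_of_deriv_pos hJc.convex hucont fun s hs ↦ ?_
    have hs' := interior_subset hs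
    rw [(hu s hs').hasDerivAt.deriv]
    exact inv_pos.2 (hpos s hs')
  set σ := Function.invFunOn u J
  have hσu (s) (hs : s ∈ J) : σ (u s) = s := humono.injOn.leftInvOn_invFunOn hs
  have hd (t) (ht : t ∈ u '' J) : HasDerivAt σ (m (σ t)) t := by
    obtain ⟨s, hs, rfl⟩ := ht
    rw [hσu s hs]
    have := (hu s hs).to_local_left_inverse (inv_pos.2 (hpos s hs)).ne' (g := σ)
      (Filter.eventually_of_mem (hJ.mem_nhds hs) hσu)
    simpa using this.hasDerivAt
  have hmaps : MapsTo σ (u '' J) J := by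
    rintro _ ⟨s, hs, rfl⟩
    rwa [hσu s hs]
  have hopen : IsOpen (u '' J) := by
    rw [isOpen_iff_mem_nhds]
    rintro _ ⟨s, hs, rfl⟩
    rw [← (hu s hs).map_nhds_eq (inv_pos.2 (hpos s hs)).ne']
    exact Filter.image_mem_map (hJ.mem_nhds hs)
  refine ⟨u '' J, σ, hopen, (hJc.isPreconnected.image u hucont).ordConnected, ?_, ?_, hd,
    contDiffOn_of_hasDerivAt_comp hm hopen hmaps hd⟩
  · refine ⟨hmaps, ?_, fun s hs ↦ ⟨u s, mem_image_of_mem u hs, hσu s hs⟩⟩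
    rintro _ ⟨s, hs, rfl⟩ _ ⟨r, hr, rfl⟩ h
    rw [hσu s hs, hσu r hr] at h
    rw [h]
  · rintro _ ⟨s, hs, rfl⟩ _ ⟨r, hr, rfl⟩ h
    rw [hσu s hs, hσu r hr]
    exact (humono.lt_iff_lt hs hr).1 h

end Flows

/-! ### The metric in a chart and the geodesic equation with lowered index. -/

section ChartForm

lemma IsLorentzBasis.eq_zero_of_forall {V : Type*} [AddCommGroup V] [Module ℝ V]
    [TopologicalSpace V] {B : V →L[ℝ] V →L[ℝ] ℝ}
    {ξ : Module.Basis (Fin 4) ℝ V} (hξ : IsLorentzBasis B ξ) {v : V} (hv : ∀ u, B u v = 0) :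
    v = 0 := by
  refine ξ.repr.map_eq_zero_iff.1 (Finsupp.ext fun i ↦ ?_)
  have h := hv (ξ i)
  rw [← ξ.sum_repr v, map_sum] at h
  simp only [map_smul, smul_eq_mul, hξ i] at h
  simp only [mul_ite, mul_zero, Finset.sum_ite_eq, Finset.mem_univ, if_true] at h
  split_ifs at h <;> simpa using h

lemma clm_apply_eq_sum_single {F : Type*} [NormedAddCommGroup F] [NormedSpace ℝ F]
    (L : R4 →L[ℝ] F) (v : R4) :
    L v = ∑ i, v i • L (EuclideanSpace.single i (1 : ℝ)) := by
  conv_lhs => rw [← (EuclideanSpace.basisFun (Fin 4) ℝ).sum_repr v, map_sum]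
  simp

variable {M : Type*} [TopologicalSpace M] [ChartedSpace R4 M] [IsManifold (𝓡 4) ∞ M]

omit [IsManifold (𝓡 4) ∞ M] in
lemma mdifferentiable_of_mem_maximalAtlas {φ : OpenPartialHomeomorph M R4}
    (hφ : φ ∈ IsManifold.maximalAtlas (𝓡 4) ∞ M) : φ.MDifferentiable (𝓡 4) (𝓡 4) :=
  ⟨(contMDiffOn_of_mem_maximalAtlas hφ).mdifferentiableOn (by simp),
    (contMDiffOn_symm_of_mem_maximalAtlas hφ).mdifferentiableOn (by simp)⟩

namespace LorentzMetric

variable (g : LorentzMetric M) {φ : OpenPartialHomeomorph M R4}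

/-- The metric read in the chart `φ`, as a field of bilinear forms on `ℝ⁴`. -/
def chartForm (φ : OpenPartialHomeomorph M R4) (y : R4) : R4 →L[ℝ] R4 →L[ℝ] ℝ :=
  -- The ascriptions use that every tangent space unfolds to `R4`; the values thus lie in one fixed
  -- normed space and can be differentiated in `y`.
  let B : R4 →L[ℝ] R4 →L[ℝ] ℝ := g.form (φ.symm y)
  let D : R4 →L[ℝ] R4 := mfderiv (𝓡 4) (𝓡 4) φ.symm y
  B.bilinearComp D D

lemma chartForm_apply (φ : OpenPartialHomeomorph M R4) (y u v : R4) :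
    g.chartForm φ y u v = g.form (φ.symm y) (mfderiv (𝓡 4) (𝓡 4) φ.symm y u)
      (mfderiv (𝓡 4) (𝓡 4) φ.symm y v) := rfl

lemma chartForm_symm (φ : OpenPartialHomeomorph M R4) (y u v : R4) :
    g.chartForm φ y u v = g.chartForm φ y v u := g.symm _ _ _

lemma components_apply (φ : OpenPartialHomeomorph M R4) (y : R4) (i j : Fin 4) :
    g.components φ y i j = g.chartForm φ y (EuclideanSpace.single i (1 : ℝ))
      (EuclideanSpace.single j (1 : ℝ)) := rfl

/-- In finite dimension it suffices to test on fixed vectors `u` and `v`. Their pushforwards are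
smooth along `φ.symm` because its tangent map is smooth, and a smooth metric pairs them smoothly. -/
lemma contDiffOn_chartForm (hφ : φ ∈ IsManifold.maximalAtlas (𝓡 4) ∞ M) :
    ContDiffOn ℝ ∞ (g.chartForm φ) φ.target := by
  rw [contDiffOn_clm_apply]
  intro u
  rw [contDiffOn_clm_apply]
  intro v
  have hs : ContMDiffOn (𝓡 4) (𝓡 4) ∞ φ.symm φ.target := contMDiffOn_symm_of_mem_maximalAtlas hφ
  have hvec (w : R4) : ContMDiffOn (𝓡 4) ((𝓡 4).prod (𝓡 4)) ∞
      (fun y : R4 ↦ TotalSpace.mk' R4 (E := (TangentSpace (𝓡 4) : M → Type _)) (φ.symm y)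
        (mfderiv (𝓡 4) (𝓡 4) φ.symm y w)) φ.target := by
    have hu : UniqueMDiffOn (𝓡 4) φ.target := φ.open_target.uniqueMDiffOn
    have hT := hs.contMDiffOn_tangentMapWithin (m := ∞) (by simp) hu
    have hw : ContMDiffOn (𝓡 4) (𝓡 4).tangent ∞ (fun y : R4 ↦ (⟨y, w⟩ : TangentBundle (𝓡 4) R4))
        φ.target := contMDiffOn_vectorSpace_iff_contDiffOn.2 contDiffOn_const
    refine (hT.comp hw fun y hy ↦ hy).congr fun y hy ↦ ?_
    simp only [Function.comp_apply, tangentMapWithin, mfderivWithin_of_isOpen φ.open_target hy]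
  have hg := g.smooth.comp_contMDiffOn hs
  have := ContMDiffOn.clm_bundle_apply₂ (F₁ := R4) (F₂ := R4) (F₃ := ℝ)
    (E₁ := (TangentSpace (𝓡 4) : M → Type _)) (E₂ := (TangentSpace (𝓡 4) : M → Type _))
    (E₃ := Bundle.Trivial M ℝ) (b := φ.symm) (ψ := fun y ↦ g.form (φ.symm y)) hg (hvec u) (hvec v)
  intro y hy
  have h := this y hy
  simp only [contMDiffWithinAt_totalSpace] at h
  exact h.2.contDiffWithinAt

lemma exists_isLorentzBasis_chartForm (hφ : φ ∈ IsManifold.maximalAtlas (𝓡 4) ∞ M) {y : R4}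
    (hy : y ∈ φ.target) : ∃ ξ, IsLorentzBasis (g.chartForm φ y) ξ := by
  obtain ⟨ξ, hξ⟩ := g.signature (φ.symm y)
  let D := (mdifferentiable_of_mem_maximalAtlas hφ).symm.mfderiv hy
  let ξ' : Module.Basis (Fin 4) ℝ R4 := ξ.map D.symm.toLinearEquiv
  have h (i : Fin 4) : mfderiv (𝓡 4) (𝓡 4) φ.symm y (ξ' i) = ξ i := D.apply_symm_apply (ξ i)
  refine ⟨ξ', fun i j ↦ ?_⟩
  rw [← hξ i j, chartForm_apply, h, h]

lemma det_components_ne_zero (hφ : φ ∈ IsManifold.maximalAtlas (𝓡 4) ∞ M) {y : R4}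
    (hy : y ∈ φ.target) : (g.components φ y).det ≠ 0 := by
  intro hdet
  obtain ⟨v, hv, h⟩ := Matrix.exists_mulVec_eq_zero_iff.2 hdet
  obtain ⟨ξ, hξ⟩ := g.exists_isLorentzBasis_chartForm hφ hy
  have h1 (i : Fin 4) : g.chartForm φ y (EuclideanSpace.single i (1 : ℝ)) (WithLp.toLp 2 v) = 0 := by
    rw [clm_apply_eq_sum_single]
    have := congrFun h i
    simp only [Matrix.mulVec, dotProduct, components_apply, Pi.zero_apply] at this
    rw [← this]
    exact Finset.sum_congr rfl fun j _ ↦ mul_comm _ _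
  have h2 : (WithLp.toLp 2 v : R4) = 0 := by
    refine hξ.eq_zero_of_forall fun u ↦ ?_
    rw [chartForm_symm, clm_apply_eq_sum_single]
    simp only [g.chartForm_symm φ y (WithLp.toLp 2 v), h1, smul_zero, Finset.sum_const_zero]
  exact hv (by simpa using congrArg WithLp.ofLp h2)

lemma contDiffOn_components (hφ : φ ∈ IsManifold.maximalAtlas (𝓡 4) ∞ M) (i j : Fin 4) :
    ContDiffOn ℝ ∞ (fun y ↦ g.components φ y i j) φ.target :=
  ((g.contDiffOn_chartForm hφ).clm_apply contDiffOn_const).clm_apply contDiffOn_const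

lemma partialComponents_apply (hφ : φ ∈ IsManifold.maximalAtlas (𝓡 4) ∞ M) {y : R4}
    (hy : y ∈ φ.target) (k i j : Fin 4) :
    g.partialComponents φ y k i j = fderiv ℝ (g.chartForm φ) y (EuclideanSpace.single k (1 : ℝ))
      (EuclideanSpace.single i (1 : ℝ)) (EuclideanSpace.single j (1 : ℝ)) := by
  have hd : DifferentiableAt ℝ (g.chartForm φ) y :=
    ((g.contDiffOn_chartForm hφ).contDiffAt (φ.open_target.mem_nhds hy)).differentiableAt (by simp)
  have := (hd.hasFDerivAt.clm_apply (hasFDerivAt_const (EuclideanSpace.single i (1 : ℝ)) y)).clm_apply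
    (hasFDerivAt_const (EuclideanSpace.single j (1 : ℝ)) y)
  unfold partialComponents
  simp only [components_apply]
  rw [this.fderiv]
  simp

lemma contDiffOn_christoffel (hφ : φ ∈ IsManifold.maximalAtlas (𝓡 4) ∞ M) (k i j : Fin 4) :
    ContDiffOn ℝ ∞ (fun y ↦ g.christoffel φ y k i j) φ.target := by
  have hdet (A : R4 → Matrix (Fin 4) (Fin 4) ℝ)
      (hA : ∀ i j, ContDiffOn ℝ ∞ (fun y ↦ A y i j) φ.target) :
      ContDiffOn ℝ ∞ (fun y ↦ (A y).det) φ.target := by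
    simp only [Matrix.det_apply']
    exact ContDiffOn.sum fun σ _ ↦ contDiffOn_const.mul (contDiffOn_prod fun i _ ↦ hA _ _)
  have hpart (k i j : Fin 4) : ContDiffOn ℝ ∞ (fun y ↦ g.partialComponents φ y k i j) φ.target :=
    ((g.contDiffOn_components hφ i j).fderiv_of_isOpen φ.open_target (by simp)).clm_apply
      contDiffOn_const
  have hinv (k l : Fin 4) : ContDiffOn ℝ ∞ (fun y ↦ (g.components φ y)⁻¹ k l) φ.target := by
    simp only [Matrix.inv_def, Matrix.smul_apply, Ring.inverse_eq_inv', Matrix.adjugate_apply]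
    refine ContDiffOn.smul ((hdet _ (g.contDiffOn_components hφ)).inv
      fun y hy ↦ g.det_components_ne_zero hφ hy) (hdet _ fun i j ↦ ?_)
    simp only [Matrix.updateRow_apply]
    split_ifs
    · exact contDiffOn_const
    · exact g.contDiffOn_components hφ i j
  unfold christoffel
  exact contDiffOn_const.mul (ContDiffOn.sum fun l _ ↦
    (hinv k l).mul (((hpart i j l).add (hpart j i l)).sub (hpart l i j)))

end LorentzMetric

/-- The lowered acceleration `g(ξⁿ ∇ₙ ξ, w)` in coordinates, for a curve with position `y`,
velocity `v` and coordinate acceleration `a` (the Euler-Lagrange expression of the energy). -/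
def lowAcc (G : R4 → R4 →L[ℝ] R4 →L[ℝ] ℝ) (y v a w : R4) : ℝ :=
  G y a w + fderiv ℝ G y v v w - 1 / 2 * fderiv ℝ G y w v v

namespace LorentzMetric

variable (g : LorentzMetric M) {φ : OpenPartialHomeomorph M R4}

/-- Lowering the index cancels the inverse matrix in the Christoffel symbols. Contracted with `v i *
v j`, the first two partial derivatives give equal sums, which cancels the factor 1/2 on them.
Geodesics can then be treated without indices. -/
lemma sum_components_mul_acceleration (hφ : φ ∈ IsManifold.maximalAtlas (𝓡 4) ∞ M) {y : R4}
    (hy : y ∈ φ.target) (v a : R4) (m : Fin 4) :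
    ∑ k, g.components φ y m k * (a k + ∑ i, ∑ j, g.christoffel φ y k i j * v i * v j) =
      lowAcc (g.chartForm φ) y v a (EuclideanSpace.single m (1 : ℝ)) := by
  have hmul : g.components φ y * (g.components φ y)⁻¹ = 1 :=
    Matrix.mul_nonsing_inv _ (g.det_components_ne_zero hφ hy).isUnit
  have hΓ (i j : Fin 4) : ∑ k, g.components φ y m k * g.christoffel φ y k i j =
      1 / 2 * (g.partialComponents φ y i j m + g.partialComponents φ y j i m
        - g.partialComponents φ y m i j) := by
    have (l : Fin 4) : ∑ k, g.components φ y m k * (g.components φ y)⁻¹ k l =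
        if m = l then 1 else 0 := by
      rw [← Matrix.mul_apply, hmul, Matrix.one_apply]
    simp only [christoffel, Finset.mul_sum]
    rw [Finset.sum_comm]
    calc _ = ∑ l, (∑ k, g.components φ y m k * (g.components φ y)⁻¹ k l) *
          (1 / 2 * (g.partialComponents φ y i j l + g.partialComponents φ y j i l
            - g.partialComponents φ y l i j)) := by
          refine Finset.sum_congr rfl fun l _ ↦ ?_
          rw [Finset.sum_mul]
          exact Finset.sum_congr rfl fun k _ ↦ by ring
      _ = _ := by simp [this]
  have hΓv : ∑ k, g.components φ y m k * ∑ i, ∑ j, g.christoffel φ y k i j * v i * v j =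
      ∑ i, ∑ j, v i * v j * (1 / 2 * (g.partialComponents φ y i j m +
        g.partialComponents φ y j i m - g.partialComponents φ y m i j)) := by
    simp only [← hΓ, Finset.mul_sum]
    rw [Finset.sum_comm]
    refine Finset.sum_congr rfl fun i _ ↦ ?_
    rw [Finset.sum_comm]
    exact Finset.sum_congr rfl fun j _ ↦ Finset.sum_congr rfl fun k _ ↦ by ring
  have h1 : ∑ k, g.components φ y m k * a k =
      g.chartForm φ y a (EuclideanSpace.single m (1 : ℝ)) := by
    rw [chartForm_symm, clm_apply_eq_sum_single]
    exact Finset.sum_congr rfl fun k _ ↦ mul_comm _ _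
  have h2 : fderiv ℝ (g.chartForm φ) y v v (EuclideanSpace.single m (1 : ℝ)) =
      ∑ i, ∑ j, v i * v j * g.partialComponents φ y i j m := by
    rw [clm_apply_eq_sum_single (fderiv ℝ (g.chartForm φ) y) v]
    simp only [sum_apply, smul_apply]
    refine Finset.sum_congr rfl fun i _ ↦ ?_
    rw [clm_apply_eq_sum_single _ v]
    simp only [sum_apply, smul_apply, smul_eq_mul, Finset.mul_sum, g.partialComponents_apply hφ hy]
    exact Finset.sum_congr rfl fun j _ ↦ by ring
  have h2' : fderiv ℝ (g.chartForm φ) y v v (EuclideanSpace.single m (1 : ℝ)) =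
      ∑ i, ∑ j, v i * v j * g.partialComponents φ y j i m := by
    rw [h2, Finset.sum_comm]
    exact Finset.sum_congr rfl fun i _ ↦ Finset.sum_congr rfl fun j _ ↦ by ring
  have h3 : fderiv ℝ (g.chartForm φ) y (EuclideanSpace.single m (1 : ℝ)) v v =
      ∑ i, ∑ j, v i * v j * g.partialComponents φ y m i j := by
    rw [clm_apply_eq_sum_single (fderiv ℝ (g.chartForm φ) y (EuclideanSpace.single m (1 : ℝ))) v]
    simp only [sum_apply, smul_apply]
    refine Finset.sum_congr rfl fun i _ ↦ ?_
    rw [clm_apply_eq_sum_single _ v]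
    simp only [smul_eq_mul, Finset.mul_sum, g.partialComponents_apply hφ hy]
    exact Finset.sum_congr rfl fun j _ ↦ by ring
  simp only [mul_add, Finset.sum_add_distrib]
  rw [hΓv, h1, lowAcc]
  have h4 : ∑ i, ∑ j, v i * v j * (1 / 2 * (g.partialComponents φ y i j m +
        g.partialComponents φ y j i m - g.partialComponents φ y m i j)) =
      1 / 2 * (∑ i, ∑ j, v i * v j * g.partialComponents φ y i j m) +
      1 / 2 * (∑ i, ∑ j, v i * v j * g.partialComponents φ y j i m) -
      1 / 2 * (∑ i, ∑ j, v i * v j * g.partialComponents φ y m i j) := by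
    simp only [Finset.mul_sum, ← Finset.sum_add_distrib, ← Finset.sum_sub_distrib]
    exact Finset.sum_congr rfl fun i _ ↦ Finset.sum_congr rfl fun j _ ↦ by ring
  rw [h4, ← h2, ← h2', ← h3]
  ring

/-- Raising the index: the acceleration vanishes iff the lowered acceleration does. -/
lemma acceleration_eq_zero_iff_lowAcc (hφ : φ ∈ IsManifold.maximalAtlas (𝓡 4) ∞ M) {y : R4}
    (hy : y ∈ φ.target) (v a : R4) :
    (∀ k, a k + ∑ i, ∑ j, g.christoffel φ y k i j * v i * v j = 0) ↔
      ∀ w, lowAcc (g.chartForm φ) y v a w = 0 := by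
  constructor
  · intro h w
    have hm (m : Fin 4) :
        lowAcc (g.chartForm φ) y v a (EuclideanSpace.single m (1 : ℝ)) = 0 := by
      rw [← g.sum_components_mul_acceleration hφ hy]
      simp [h]
    -- `lowAcc` is linear in its last argument, so the coordinate vectors suffice.
    let L : R4 →L[ℝ] ℝ := g.chartForm φ y a + fderiv ℝ (g.chartForm φ) y v v -
      (1 / 2 : ℝ) • ((fderiv ℝ (g.chartForm φ) y).flip v).flip v
    have hL (w : R4) : L w = lowAcc (g.chartForm φ) y v a w := by
      simp [L, lowAcc]
    rw [← hL, clm_apply_eq_sum_single]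
    simp [hL, hm]
  · intro h
    by_contra! hne
    obtain ⟨k, hk⟩ := hne
    refine g.det_components_ne_zero hφ hy (Matrix.exists_mulVec_eq_zero_iff.1
      ⟨fun k ↦ a k + ∑ i, ∑ j, g.christoffel φ y k i j * v i * v j, fun h0 ↦ hk (congrFun h0 k), ?_⟩)
    funext m
    simp only [Matrix.mulVec, dotProduct]
    rw [g.sum_components_mul_acceleration hφ hy, h, Pi.zero_apply]

end LorentzMetric

end ChartForm

/-! ### Curves on arbitrary intervals and independence of the chart. -/

section Curves

/-- This makes one-sided derivatives at end points unique, so derivatives within `S` agree with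
those of any smooth extension. -/
lemma IsInterval.uniqueDiffOn {S : Set ℝ} (hS : IsInterval S) : UniqueDiffOn ℝ S := by
  obtain ⟨a, ha, b, hb, hab⟩ := hS.2.exists_lt
  refine uniqueDiffOn_convex hS.1.convex ⟨(a + b) / 2, ?_⟩
  exact interior_mono (Ioo_subset_Icc_self.trans (hS.1.out ha hb))
    (by rw [isOpen_Ioo.interior_eq]; constructor <;> linarith)

section Calculus

variable {E F : Type*} [NormedAddCommGroup E] [NormedSpace ℝ E] [NormedAddCommGroup F]
  [NormedSpace ℝ F]

lemma ContDiffAt.two_of_infty {f : E → F} {x : E} (hf : ContDiffAt ℝ ∞ f x) :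
    ContDiffAt ℝ 2 f x := by
  exact_mod_cast contDiffAt_infty.1 hf 2

lemma ContDiffAt.differentiableAt_deriv {x : ℝ → E} {s : ℝ} (hx : ContDiffAt ℝ 2 x s) :
    DifferentiableAt ℝ (deriv x) s := by
  have h : DifferentiableAt ℝ (fderiv ℝ x) s :=
    (hx.fderiv_right (m := 1) (by norm_num)).differentiableAt (by simp)
  have := h.clm_apply (differentiableAt_const (1 : ℝ))
  simpa only [fderiv_apply_one_eq_deriv] using this

lemma HasDerivAt.bilin_apply {B : ℝ → E →L[ℝ] E →L[ℝ] F} {B' : E →L[ℝ] E →L[ℝ] F}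
    {p q : ℝ → E} {p' q' : E} {t : ℝ} (hB : HasDerivAt B B' t) (hp : HasDerivAt p p' t)
    (hq : HasDerivAt q q' t) :
    HasDerivAt (fun t ↦ B t (p t) (q t))
      (B' (p t) (q t) + B t p' (q t) + B t (p t) q') t := by
  simpa using (hB.clm_apply hp).clm_apply hq

/-- The second derivative of a curve under a change of coordinates. -/
lemma deriv_deriv_comp {ψ : E → F} {x : ℝ → E} {s : ℝ} (hψ : ContDiffAt ℝ 2 ψ (x s))
    (hx : ContDiffAt ℝ 2 x s) :
    deriv (ψ ∘ x) s = fderiv ℝ ψ (x s) (deriv x s) ∧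
    deriv (deriv (ψ ∘ x)) s = fderiv ℝ (fderiv ℝ ψ) (x s) (deriv x s) (deriv x s) +
      fderiv ℝ ψ (x s) (deriv (deriv x) s) := by
  have h1 : ∀ᶠ t in nhds s, deriv (ψ ∘ x) t = fderiv ℝ ψ (x t) (deriv x t) := by
    filter_upwards [hx.eventually (by simp), hx.continuousAt.eventually (hψ.eventually (by simp))]
      with t ht ht'
    exact ((ht'.differentiableAt (by simp)).hasFDerivAt.comp_hasDerivAt t
      (ht.differentiableAt (by simp)).hasDerivAt).deriv
  refine ⟨h1.self_of_nhds, ?_⟩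
  rw [Filter.EventuallyEq.deriv_eq h1]
  have h2 : HasFDerivAt (fderiv ℝ ψ) (fderiv ℝ (fderiv ℝ ψ) (x s)) (x s) :=
    ((hψ.fderiv_right (m := 1) (by norm_num)).differentiableAt (by simp)).hasFDerivAt
  exact ((h2.comp_hasDerivAt s (hx.differentiableAt (by simp)).hasDerivAt).clm_apply
    hx.differentiableAt_deriv.hasDerivAt).deriv

lemma DifferentiableAt.hasDerivAt_comp_curve {H : E → F} {f : ℝ → E} {f' : E} {t : ℝ}
    (hH : DifferentiableAt ℝ H (f t)) (hf : HasDerivAt f f' t) :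
    HasDerivAt (fun t ↦ H (f t)) (fderiv ℝ H (f t) f') t :=
  hH.hasFDerivAt.comp_hasDerivAt t hf

/-- The derivative of a pulled back field of bilinear forms. -/
lemma fderiv_pullback_apply {G : E → E →L[ℝ] E →L[ℝ] ℝ} {H : F → F →L[ℝ] F →L[ℝ] ℝ} {ψ : E → F}
    {y : E} (hψ : ContDiffAt ℝ 2 ψ y) (hH : DifferentiableAt ℝ H (ψ y))
    (hG : ∀ᶠ z in nhds y, G z = (H (ψ z)).bilinearComp (fderiv ℝ ψ z) (fderiv ℝ ψ z))
    (hGd : DifferentiableAt ℝ G y) (z p q : E) :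
    fderiv ℝ G y z p q =
      fderiv ℝ H (ψ y) (fderiv ℝ ψ y z) (fderiv ℝ ψ y p) (fderiv ℝ ψ y q) +
      H (ψ y) (fderiv ℝ (fderiv ℝ ψ) y z p) (fderiv ℝ ψ y q) +
      H (ψ y) (fderiv ℝ ψ y p) (fderiv ℝ (fderiv ℝ ψ) y z q) := by
  -- Restriction to the line through `y` in direction `z` reduces the claim to a product rule in one
  -- variable.
  set l : ℝ → E := fun t ↦ y + t • z with hl_def
  have hl0 : l 0 = y := by simp [hl_def]
  have hl : HasDerivAt l z 0 := by
    simpa only [one_smul, id] using ((hasDerivAt_id (0 : ℝ)).smul_const z).const_add y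
  have hlt : Filter.Tendsto l (nhds 0) (nhds y) := by
    have := hl.continuousAt.tendsto
    rwa [hl0] at this
  have hψd : HasFDerivAt ψ (fderiv ℝ ψ y) (l 0) := by
    rw [hl0]; exact (hψ.differentiableAt (by simp)).hasFDerivAt
  have hψl : HasDerivAt (fun t ↦ ψ (l t)) (fderiv ℝ ψ y z) 0 := hψd.comp_hasDerivAt 0 hl
  have hψd2 : HasFDerivAt (fderiv ℝ ψ) (fderiv ℝ (fderiv ℝ ψ) y) (l 0) := by
    rw [hl0]
    exact ((hψ.fderiv_right (m := 1) (by norm_num)).differentiableAt (by simp)).hasFDerivAt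
  have hD (p : E) : HasDerivAt (fun t ↦ fderiv ℝ ψ (l t) p) (fderiv ℝ (fderiv ℝ ψ) y z p) 0 := by
    simpa using (hψd2.comp_hasDerivAt 0 hl).clm_apply (hasDerivAt_const (0 : ℝ) p)
  have hHl : HasDerivAt (fun t ↦ H (ψ (l t))) (fderiv ℝ H (ψ y) (fderiv ℝ ψ y z)) 0 := by
    have := DifferentiableAt.hasDerivAt_comp_curve (F := F →L[ℝ] F →L[ℝ] ℝ) (H := H)
      (f := fun t ↦ ψ (l t)) (t := 0) (by rwa [hl0]) hψl
    rwa [hl0] at this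
  have hGl : HasDerivAt (fun t ↦ G (l t)) (fderiv ℝ G y z) 0 := by
    have := DifferentiableAt.hasDerivAt_comp_curve (F := E →L[ℝ] E →L[ℝ] ℝ) (H := G)
      (f := l) (t := 0) (by rwa [hl0]) hl
    rwa [hl0] at this
  have h1 : HasDerivAt (fun t ↦ G (l t) p q) (fderiv ℝ G y z p q) 0 := by
    simpa using hGl.bilin_apply (hasDerivAt_const 0 p) (hasDerivAt_const 0 q)
  have h2 := hHl.bilin_apply (hD p) (hD q)
  have h3 := h1.unique (h2.congr_of_eventuallyEq
    ((hlt.eventually hG).mono fun t ht ↦ by simp [ht]))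
  rw [hl0] at h3
  exact h3

end Calculus

/-- The Euler-Lagrange expression is invariant under a change of coordinates. -/
lemma lowAcc_comp {G H : R4 → R4 →L[ℝ] R4 →L[ℝ] ℝ} {ψ : R4 → R4} {y : R4}
    (hψ : ContDiffAt ℝ 2 ψ y) (hH : DifferentiableAt ℝ H (ψ y))
    (hsymm : ∀ u v, H (ψ y) u v = H (ψ y) v u)
    (hG : ∀ᶠ z in nhds y, G z = (H (ψ z)).bilinearComp (fderiv ℝ ψ z) (fderiv ℝ ψ z))
    (hGd : DifferentiableAt ℝ G y) (v a w : R4) :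
    lowAcc G y v a w = lowAcc H (ψ y) (fderiv ℝ ψ y v)
      (fderiv ℝ (fderiv ℝ ψ) y v v + fderiv ℝ ψ y a) (fderiv ℝ ψ y w) := by
  have hD2 (p q : R4) : fderiv ℝ (fderiv ℝ ψ) y p q = fderiv ℝ (fderiv ℝ ψ) y q p :=
    (hψ.isSymmSndFDerivAt (by simp)).eq p q
  have hGy : ∀ p q, G y p q = H (ψ y) (fderiv ℝ ψ y p) (fderiv ℝ ψ y q) := fun p q ↦ by
    rw [hG.self_of_nhds]; rfl
  simp only [lowAcc, fderiv_pullback_apply hψ hH hG hGd, hGy, map_add, add_apply]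
  -- By symmetry of the second derivative and of `H`, the terms containing D²ψ(v, w) cancel; D²ψ(v,
  -- v) remains and is the correction to the acceleration.
  rw [hD2 w v, hsymm (fderiv ℝ (fderiv ℝ ψ) y v w)]
  ring

variable {M : Type*} [TopologicalSpace M] [ChartedSpace R4 M] [IsManifold (𝓡 4) ∞ M]

namespace LorentzMetric

variable (g : LorentzMetric M) {φ φ' : OpenPartialHomeomorph M R4}

omit [IsManifold (𝓡 4) ∞ M] in
lemma contDiffAt_transition (hφ : φ ∈ IsManifold.maximalAtlas (𝓡 4) ∞ M)
    (hφ' : φ' ∈ IsManifold.maximalAtlas (𝓡 4) ∞ M) {y : R4} (hy : y ∈ φ.target)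
    (hy' : φ.symm y ∈ φ'.source) : ContDiffAt ℝ ∞ (φ' ∘ φ.symm) y := by
  rw [← contMDiffAt_iff_contDiffAt]
  exact (contMDiffAt_of_mem_maximalAtlas hφ' hy').comp y (contMDiffAt_symm_of_mem_maximalAtlas hφ hy)

lemma chartForm_transition (hφ : φ ∈ IsManifold.maximalAtlas (𝓡 4) ∞ M)
    (hφ' : φ' ∈ IsManifold.maximalAtlas (𝓡 4) ∞ M) {y : R4} (hy : y ∈ φ.target)
    (hy' : φ.symm y ∈ φ'.source) :
    g.chartForm φ y = (g.chartForm φ' ((φ' ∘ φ.symm) y)).bilinearComp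
      (fderiv ℝ (φ' ∘ φ.symm) y) (fderiv ℝ (φ' ∘ φ.symm) y) := by
  have hd := (contDiffAt_transition hφ hφ' hy hy').differentiableAt (by simp)
  have h1 : HasMFDerivAt (𝓡 4) (𝓡 4) (φ' ∘ φ.symm) y (fderiv ℝ (φ' ∘ φ.symm) y) :=
    hd.hasFDerivAt.hasMFDerivAt
  have h2 : HasMFDerivAt (𝓡 4) (𝓡 4) φ'.symm ((φ' ∘ φ.symm) y)
      (mfderiv (𝓡 4) (𝓡 4) φ'.symm ((φ' ∘ φ.symm) y)) :=
    ((mdifferentiable_of_mem_maximalAtlas hφ').mdifferentiableAt_symm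
      (φ'.map_source hy')).hasMFDerivAt
  have h3 : φ.symm =ᶠ[nhds y] φ'.symm ∘ (φ' ∘ φ.symm) := by
    filter_upwards [(φ.continuousAt_symm hy).preimage_mem_nhds (φ'.open_source.mem_nhds hy')]
      with z hz
    exact (φ'.left_inv hz).symm
  have h4 := ((h2.comp y h1).congr_of_eventuallyEq h3).mfderiv
  have h5 : φ'.symm ((φ' ∘ φ.symm) y) = φ.symm y := φ'.left_inv hy'
  -- The two base points are equal only propositionally; vectors are regarded as elements of `R4` to
  -- move the form from one to the other.
  have key (p : M) (hp : p = φ.symm y) (u v : R4) :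
      g.form (φ.symm y) (u : R4) (v : R4) = g.form p (u : R4) (v : R4) := by subst hp; rfl
  ext u v
  rw [chartForm_apply, h4]
  exact key _ h5 _ _

lemma lowAcc_transition (hφ : φ ∈ IsManifold.maximalAtlas (𝓡 4) ∞ M)
    (hφ' : φ' ∈ IsManifold.maximalAtlas (𝓡 4) ∞ M) {y : R4} (hy : y ∈ φ.target)
    (hy' : φ.symm y ∈ φ'.source) (v a w : R4) :
    lowAcc (g.chartForm φ) y v a w = lowAcc (g.chartForm φ') ((φ' ∘ φ.symm) y)
      (fderiv ℝ (φ' ∘ φ.symm) y v)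
      (fderiv ℝ (fderiv ℝ (φ' ∘ φ.symm)) y v v + fderiv ℝ (φ' ∘ φ.symm) y a)
      (fderiv ℝ (φ' ∘ φ.symm) y w) := by
  have hdiff {φ : OpenPartialHomeomorph M R4} (hφ : φ ∈ IsManifold.maximalAtlas (𝓡 4) ∞ M) {y : R4}
      (hy : y ∈ φ.target) : DifferentiableAt ℝ (g.chartForm φ) y :=
    ((g.contDiffOn_chartForm hφ).contDiffAt (φ.open_target.mem_nhds hy)).differentiableAt (by simp)
  refine lowAcc_comp (contDiffAt_transition hφ hφ' hy hy').two_of_infty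
    (hdiff hφ' (φ'.map_source hy')) (g.chartForm_symm φ' _) ?_ (hdiff hφ hy) v a w
  filter_upwards [φ.open_target.mem_nhds hy,
    (φ.continuousAt_symm hy).preimage_mem_nhds (φ'.open_source.mem_nhds hy')] with z hz hz'
  exact g.chartForm_transition hφ hφ' hz hz'

end LorentzMetric

variable {S J : Set ℝ} {γ F : ℝ → M} {s : ℝ} {φ : OpenPartialHomeomorph M R4}

omit [IsManifold (𝓡 4) ∞ M] in
lemma contDiffAt_chart_curve (hφ : φ ∈ IsManifold.maximalAtlas (𝓡 4) ∞ M) (hJ : IsOpen J)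
    (hF : ContMDiffOn 𝓘(ℝ, ℝ) (𝓡 4) ∞ F J) (hs : s ∈ J) (hsφ : F s ∈ φ.source) :
    ContDiffAt ℝ ∞ (φ ∘ F) s := by
  rw [← contMDiffAt_iff_contDiffAt]
  exact (contMDiffAt_of_mem_maximalAtlas hφ hsφ).comp s (hF.contMDiffAt (hJ.mem_nhds hs))

namespace LorentzMetric

variable (g : LorentzMetric M)

/-- Here and in `acceleration_eq`, derivatives of `γ` within `S` become ordinary derivatives of a
smooth extension `F` on an open set, so end points need no separate treatment. -/
lemma form_tangentVector (hφ : φ ∈ IsManifold.maximalAtlas (𝓡 4) ∞ M) (hS : IsInterval S)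
    (hJ : IsOpen J) (hSJ : S ⊆ J) (hF : ContMDiffOn 𝓘(ℝ, ℝ) (𝓡 4) ∞ F J) (hFγ : EqOn F γ S)
    (hs : s ∈ S) (hsφ : F s ∈ φ.source) :
    g.form (γ s) (tangentVector S γ s) (tangentVector S γ s) =
      g.chartForm φ (φ (F s)) (deriv (φ ∘ F) s) (deriv (φ ∘ F) s) := by
  have hx := (contDiffAt_chart_curve hφ hJ hF (hSJ hs) hsφ).differentiableAt (by simp)
  have h1 : HasMFDerivAt 𝓘(ℝ, ℝ) (𝓡 4) (φ ∘ F) s (fderiv ℝ (φ ∘ F) s) :=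
    hx.hasFDerivAt.hasMFDerivAt
  have h2 : HasMFDerivAt (𝓡 4) (𝓡 4) φ.symm ((φ ∘ F) s)
      (mfderiv (𝓡 4) (𝓡 4) φ.symm ((φ ∘ F) s)) :=
    ((mdifferentiable_of_mem_maximalAtlas hφ).mdifferentiableAt_symm
      (φ.map_source hsφ)).hasMFDerivAt
  have hFc : ContinuousAt F s := (hF.contMDiffAt (hJ.mem_nhds (hSJ hs))).continuousAt
  have h3 : γ =ᶠ[nhdsWithin s S] φ.symm ∘ (φ ∘ F) := by
    filter_upwards [self_mem_nhdsWithin,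
      nhdsWithin_le_nhds (hFc.preimage_mem_nhds (φ.open_source.mem_nhds hsφ))] with t ht ht'
    rw [← hFγ ht]
    exact (φ.left_inv ht').symm
  have h4 := (((h2.comp s h1).hasMFDerivWithinAt (s := S)).congr_of_eventuallyEq h3
    (h3.self_of_nhdsWithin hs)).mfderivWithin (hS.uniqueDiffOn s hs).uniqueMDiffWithinAt
  have h5 : φ.symm ((φ ∘ F) s) = γ s := by rw [← hFγ hs]; exact φ.left_inv hsφ
  have key (p : M) (hp : p = γ s) (u v : R4) :
      g.form (γ s) (u : R4) (v : R4) = g.form p (u : R4) (v : R4) := by subst hp; rfl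
  rw [tangentVector, h4]
  exact key _ h5 _ _

lemma acceleration_eq (hφ : φ ∈ IsManifold.maximalAtlas (𝓡 4) ∞ M) (hS : IsInterval S)
    (hJ : IsOpen J) (hSJ : S ⊆ J) (hF : ContMDiffOn 𝓘(ℝ, ℝ) (𝓡 4) ∞ F J) (hFγ : EqOn F γ S)
    (hs : s ∈ S) (hsφ : F s ∈ φ.source) (k : Fin 4) :
    g.acceleration φ S γ s k = deriv (deriv (φ ∘ F)) s k +
      ∑ i, ∑ j, g.christoffel φ (φ (F s)) k i j * deriv (φ ∘ F) s i * deriv (φ ∘ F) s j := by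
  have hx := contDiffAt_chart_curve hφ hJ hF (hSJ hs) hsφ
  have hFc : ContinuousAt F s := (hF.contMDiffAt (hJ.mem_nhds (hSJ hs))).continuousAt
  have hd1 (t) (ht : t ∈ S) (htφ : F t ∈ φ.source) :
      derivWithin (fun t ↦ φ (γ t)) S t = deriv (φ ∘ F) t := by
    rw [← ((contDiffAt_chart_curve hφ hJ hF (hSJ ht) htφ).differentiableAt (by simp)).derivWithin
      (hS.uniqueDiffOn t ht)]
    exact derivWithin_congr (fun r hr ↦ by simp [hFγ hr]) (by simp [hFγ ht])
  have hd2 : derivWithin (derivWithin (fun t ↦ φ (γ t)) S) S s = deriv (deriv (φ ∘ F)) s := by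
    have hdd : DifferentiableAt ℝ (deriv (φ ∘ F)) s :=
      hx.two_of_infty.differentiableAt_deriv
    rw [← hdd.derivWithin (hS.uniqueDiffOn s hs)]
    refine Filter.EventuallyEq.derivWithin_eq ?_ (hd1 s hs hsφ)
    filter_upwards [self_mem_nhdsWithin,
      nhdsWithin_le_nhds (hFc.preimage_mem_nhds (φ.open_source.mem_nhds hsφ))] with t ht ht'
    exact hd1 t ht ht'
  rw [acceleration, hd2, hd1 s hs hsφ, hFγ hs]

lemma acceleration_eq_zero_iff (hφ : φ ∈ IsManifold.maximalAtlas (𝓡 4) ∞ M) (hS : IsInterval S)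
    (hJ : IsOpen J) (hSJ : S ⊆ J) (hF : ContMDiffOn 𝓘(ℝ, ℝ) (𝓡 4) ∞ F J) (hFγ : EqOn F γ S)
    (hs : s ∈ S) (hsφ : F s ∈ φ.source) :
    (∀ k, g.acceleration φ S γ s k = 0) ↔ ∀ w, lowAcc (g.chartForm φ) (φ (F s))
      (deriv (φ ∘ F) s) (deriv (deriv (φ ∘ F)) s) w = 0 := by
  rw [← g.acceleration_eq_zero_iff_lowAcc hφ (φ.map_source hsφ)]
  simp only [g.acceleration_eq hφ hS hJ hSJ hF hFγ hs hsφ]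

/-- It suffices to check the geodesic equation in one chart around every point of the curve. -/
lemma isGeodesic_of_lowAcc (hS : IsInterval S)
    (hJ : IsOpen J) (hSJ : S ⊆ J) (hF : ContMDiffOn 𝓘(ℝ, ℝ) (𝓡 4) ∞ F J) (hFγ : EqOn F γ S)
    (h : ∀ s ∈ S, ∃ φ ∈ IsManifold.maximalAtlas (𝓡 4) ∞ M, F s ∈ φ.source ∧
      ∀ w, lowAcc (g.chartForm φ) (φ (F s)) (deriv (φ ∘ F) s) (deriv (deriv (φ ∘ F)) s) w = 0) :
    g.IsGeodesic S γ := by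
  intro s hs φ hφ hsφ
  rw [← hFγ hs] at hsφ
  rw [g.acceleration_eq_zero_iff hφ hS hJ hSJ hF hFγ hs hsφ]
  obtain ⟨φ', hφ', hsφ', h0⟩ := h s hs
  intro w
  have hx2 := (contDiffAt_chart_curve hφ hJ hF (hSJ hs) hsφ).two_of_infty
  have hy2 : φ (F s) ∈ φ.target := φ.map_source hsφ
  have hy2' : φ.symm (φ (F s)) ∈ φ'.source := by rwa [φ.left_inv hsφ]
  rw [g.lowAcc_transition hφ hφ' hy2 hy2']
  have hFc : ContinuousAt F s := (hF.contMDiffAt (hJ.mem_nhds (hSJ hs))).continuousAt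
  have heq : φ' ∘ F =ᶠ[nhds s] (φ' ∘ φ.symm) ∘ (φ ∘ F) := by
    filter_upwards [hFc.preimage_mem_nhds (φ.open_source.mem_nhds hsφ)] with t ht
    simp only [Function.comp_apply, φ.left_inv ht]
  -- The second derivative of the transition map entering the new coordinate acceleration is exactly
  -- the correction in `lowAcc_transition`.
  obtain ⟨hd1, hd2⟩ := deriv_deriv_comp (x := φ ∘ F)
    (contDiffAt_transition hφ hφ' hy2 hy2').two_of_infty hx2
  rw [← heq.deriv_eq] at hd1
  rw [← heq.deriv.deriv_eq] at hd2
  have hpt : (φ' ∘ φ.symm) (φ (F s)) = φ' (F s) := by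
    simp only [Function.comp_apply, φ.left_inv hsφ]
  simp only [Function.comp_apply] at hd1 hd2
  have := h0 (fderiv ℝ (φ' ∘ φ.symm) (φ (F s)) w)
  rw [hd1, hd2] at this
  rw [hpt]
  exact this

end LorentzMetric

end Curves

/-! ### From conditions on curves to proportional metrics. -/

section PointwiseConsequences

variable {M : Type*} [TopologicalSpace M] [ChartedSpace R4 M] [IsManifold (𝓡 4) ∞ M]
  {φ : OpenPartialHomeomorph M R4}

omit [IsManifold (𝓡 4) ∞ M] in
lemma contMDiffOn_chart_symm_comp (hφ : φ ∈ IsManifold.maximalAtlas (𝓡 4) ∞ M) {J : Set ℝ}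
    {x : ℝ → R4} (hx : ContDiffOn ℝ ∞ x J) (hmem : MapsTo x J φ.target) :
    ContMDiffOn 𝓘(ℝ, ℝ) (𝓡 4) ∞ (φ.symm ∘ x) J :=
  (contMDiffOn_symm_of_mem_maximalAtlas hφ).comp hx.contMDiffOn hmem

omit [ChartedSpace R4 M] [IsManifold (𝓡 4) ∞ M] in
lemma chart_comp_symm_comp_eventuallyEq {J : Set ℝ} (hJ : IsOpen J) {x : ℝ → R4}
    (hmem : MapsTo x J φ.target) {s : ℝ} (hs : s ∈ J) :
    φ ∘ (φ.symm ∘ x) =ᶠ[nhds s] x := by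
  filter_upwards [hJ.mem_nhds hs] with t ht
  exact φ.right_inv (hmem ht)

lemma isInterval_Ioo {a b : ℝ} (hab : a < b) : IsInterval (Ioo a b) :=
  ⟨ordConnected_Ioo, (Ioo_infinite hab).nontrivial⟩

namespace LorentzMetric

variable (g h : LorentzMetric M)

lemma chartForm_mfderiv (hφ : φ ∈ IsManifold.maximalAtlas (𝓡 4) ∞ M) {p : M} (hp : p ∈ φ.source)
    (u v : TangentSpace (𝓡 4) p) :
    g.chartForm φ (φ p) (mfderiv (𝓡 4) (𝓡 4) φ p u) (mfderiv (𝓡 4) (𝓡 4) φ p v) =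
      g.form p u v := by
  have h1 := (mdifferentiable_of_mem_maximalAtlas hφ).symm_comp_deriv hp
  have h2 (w : TangentSpace (𝓡 4) p) :
      mfderiv (𝓡 4) (𝓡 4) φ.symm (φ p) (mfderiv (𝓡 4) (𝓡 4) φ p w) = w :=
    congrArg (fun L ↦ L w) h1
  have key (q : M) (hq : q = p) (u v : R4) :
      g.form q (u : R4) (v : R4) = g.form p (u : R4) (v : R4) := by subst hq; rfl
  exact (congrArg₂ (fun a b : R4 ↦ g.form (φ.symm (φ p)) a b) (h2 u) (h2 v)).trans
    (key _ (φ.left_inv hp) u v)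

lemma differentiableAt_chartForm (hφ : φ ∈ IsManifold.maximalAtlas (𝓡 4) ∞ M) {y : R4}
    (hy : y ∈ φ.target) : DifferentiableAt ℝ (g.chartForm φ) y :=
  ((g.contDiffOn_chartForm hφ).contDiffAt (φ.open_target.mem_nhds hy)).differentiableAt (by simp)

/-- Metrics whose timelike curves are timelike for another one have the same property for
vectors. -/
lemma timelike_vector_of_timelike_curve
    (H : ∀ (S : Set ℝ) (γ : ℝ → M), IsCurve S γ → g.IsTimelike S γ → h.IsTimelike S γ)
    (p : M) (v : TangentSpace (𝓡 4) p) (hv : 0 < g.form p v v) : 0 < h.form p v v := by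
  set φ := chartAt R4 p
  have hφ : φ ∈ IsManifold.maximalAtlas (𝓡 4) ∞ M := IsManifold.chart_mem_maximalAtlas p
  have hp : p ∈ φ.source := mem_chart_source R4 p
  let w : R4 := mfderiv (𝓡 4) (𝓡 4) φ p v
  have hw (k : LorentzMetric M) : k.chartForm φ (φ p) w w = k.form p v v :=
    k.chartForm_mfderiv hφ hp v v
  set x : ℝ → R4 := fun t ↦ φ p + t • w
  have hx0 : x 0 = φ p := by simp [x]
  have hx : ContDiff ℝ ∞ x := by fun_prop
  have hxd (t : ℝ) : deriv x t = w := by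
    have : HasDerivAt x ((1 : ℝ) • w) t := ((hasDerivAt_id t).smul_const w).const_add (φ p)
    rw [this.deriv, one_smul]
  have hpos : ∀ᶠ t in nhds (0 : ℝ), x t ∈ φ.target ∧ 0 < g.chartForm φ (x t) w w := by
    have h1 : ∀ᶠ y in nhds (φ p), y ∈ φ.target ∧ 0 < g.chartForm φ y w w := by
      refine Filter.Eventually.and (φ.open_target.mem_nhds (φ.map_source hp)) ?_
      have : ContinuousAt (fun y ↦ g.chartForm φ y w w) (φ p) :=
        (((g.contDiffOn_chartForm hφ).clm_apply contDiffOn_const).clm_apply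
          contDiffOn_const).continuousOn.continuousAt
          (φ.open_target.mem_nhds (φ.map_source hp))
      exact this.eventually (lt_mem_nhds (hv.trans_eq (hw g).symm))
    exact (hx0 ▸ hx.continuous.tendsto 0).eventually h1
  obtain ⟨ε, hε, hball⟩ := Metric.eventually_nhds_iff_ball.1 hpos
  simp only [Real.ball_eq_Ioo, zero_sub, zero_add] at hball
  have hmem : MapsTo x (Ioo (-ε) ε) φ.target := fun t ht ↦ (hball t ht).1
  have hF := contMDiffOn_chart_symm_comp hφ hx.contDiffOn hmem
  have hS : IsInterval (Ioo (-ε) ε) := isInterval_Ioo (by linarith)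
  have htv (k : LorentzMetric M) (t) (ht : t ∈ Ioo (-ε) ε) :
      k.form ((φ.symm ∘ x) t) (tangentVector (Ioo (-ε) ε) (φ.symm ∘ x) t)
        (tangentVector (Ioo (-ε) ε) (φ.symm ∘ x) t) = k.chartForm φ (x t) w w := by
    rw [k.form_tangentVector hφ hS isOpen_Ioo subset_rfl hF (fun _ _ ↦ rfl) ht
      (φ.map_target (hmem ht)), (chart_comp_symm_comp_eventuallyEq isOpen_Ioo hmem ht).deriv_eq,
      hxd, Function.comp_apply, φ.right_inv (hmem ht)]
  have h0 : (0 : ℝ) ∈ Ioo (-ε) ε := by simpa using hε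
  have := H _ _ ⟨hS, Ioo (-ε) ε, isOpen_Ioo, ordConnected_Ioo, subset_rfl, _, hF, fun _ _ ↦ rfl⟩
    (fun t ht ↦ by rw [htv g t ht]; exact (hball t ht).2) 0 h0
  rwa [htv h 0 h0, hx0, hw] at this

/-- Local existence of null geodesics, in a chart. -/
lemma exists_null_geodesic_chart (hφ : φ ∈ IsManifold.maximalAtlas (𝓡 4) ∞ M) {y w : R4}
    (hy : y ∈ φ.target) (hw : g.chartForm φ y w w = 0) :
    ∃ ε > 0, ∃ x : ℝ → R4, x 0 = y ∧ deriv x 0 = w ∧ MapsTo x (Ioo (-ε) ε) φ.target ∧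
      ContDiffOn ℝ ∞ x (Ioo (-ε) ε) ∧
      ∀ t ∈ Ioo (-ε) ε, g.chartForm φ (x t) (deriv x t) (deriv x t) = 0 ∧
        ∀ z, lowAcc (g.chartForm φ) (x t) (deriv x t) (deriv (deriv x) t) z = 0 := by
  -- The geodesic equation as a first-order system for position and velocity.
  set f : R4 × R4 → R4 × R4 := fun q ↦ (q.2, WithLp.toLp 2 fun k ↦
    -∑ i, ∑ j, g.christoffel φ q.1 k i j * q.2 i * q.2 j) with hf_def
  have hf : ContDiffOn ℝ ∞ f (φ.target ×ˢ univ) := by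
    refine contDiffOn_snd.prodMk ?_
    rw [contDiffOn_euclidean]
    intro k
    refine ContDiffOn.neg (ContDiffOn.sum fun i _ ↦ ContDiffOn.sum fun j _ ↦ ?_)
    have hc : ContDiffOn ℝ ∞ (fun q : R4 × R4 ↦ g.christoffel φ q.1 k i j) (φ.target ×ˢ univ) :=
      (g.contDiffOn_christoffel hφ k i j).comp contDiffOn_fst fun q hq ↦ hq.1
    have hv (i : Fin 4) : ContDiffOn ℝ ∞ (fun q : R4 × R4 ↦ q.2 i) (φ.target ×ˢ univ) :=
      contDiffOn_euclidean.1 contDiffOn_snd i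
    exact (hc.mul (hv i)).mul (hv j)
  obtain ⟨ε, hε, α, hα0, hmem, hα, hsm⟩ := exists_smooth_integralCurve
    (φ.open_target.prod isOpen_univ) hf (x₀ := (y, w)) ⟨hy, mem_univ _⟩
  set x : ℝ → R4 := fun t ↦ (α t).1
  have hmemx : MapsTo x (Ioo (-ε) ε) φ.target := fun t ht ↦ (hmem ht).1
  have h0 : (0 : ℝ) ∈ Ioo (-ε) ε := by simpa using hε
  have hx1 (t) (ht : t ∈ Ioo (-ε) ε) : HasDerivAt x (α t).2 t := (hα t ht).fst
  have hx2 (t) (ht : t ∈ Ioo (-ε) ε) : HasDerivAt (fun t ↦ (α t).2) (f (α t)).2 t := (hα t ht).snd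
  have hdx (t) (ht : t ∈ Ioo (-ε) ε) : deriv x =ᶠ[nhds t] fun t ↦ (α t).2 := by
    filter_upwards [isOpen_Ioo.mem_nhds ht] with r hr using (hx1 r hr).deriv
  have hlow (t) (ht : t ∈ Ioo (-ε) ε) (z : R4) :
      lowAcc (g.chartForm φ) (x t) (deriv x t) (deriv (deriv x) t) z = 0 := by
    refine (g.acceleration_eq_zero_iff_lowAcc hφ (hmemx ht) _ _).1 (fun k ↦ ?_) z
    rw [(hdx t ht).deriv_eq, (hx2 t ht).deriv, (hx1 t ht).deriv]
    simp [hf_def, x]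
  -- The derivative of g(x', x') is twice `lowAcc` evaluated on the velocity, so a geodesic that
  -- starts null stays null.
  have hconst : ∀ t ∈ Ioo (-ε) ε,
      HasDerivAt (fun t ↦ g.chartForm φ (x t) (α t).2 (α t).2) 0 t := by
    intro t ht
    have hG := DifferentiableAt.hasDerivAt_comp_curve (F := R4 →L[ℝ] R4 →L[ℝ] ℝ)
      (g.differentiableAt_chartForm hφ (hmemx ht)) (hx1 t ht)
    have h1 := hG.bilin_apply (hx2 t ht) (hx2 t ht)
    have h2 := hlow t ht (α t).2
    rw [(hdx t ht).deriv_eq, (hx2 t ht).deriv, (hx1 t ht).deriv, lowAcc] at h2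
    refine h1.congr_deriv ?_
    rw [g.chartForm_symm φ (x t) (α t).2]
    linarith
  have hnull (t) (ht : t ∈ Ioo (-ε) ε) : g.chartForm φ (x t) (α t).2 (α t).2 = 0 := by
    have := isOpen_Ioo.is_const_of_deriv_eq_zero isPreconnected_Ioo
      (fun t ht ↦ (hconst t ht).differentiableAt.differentiableWithinAt)
      (fun t ht ↦ (hconst t ht).deriv) ht h0
    rw [this]
    simpa [x, hα0] using hw
  refine ⟨ε, hε, x, by simp [x, hα0], by simp [(hx1 0 h0).deriv, hα0], hmemx, hsm.fst,
    fun t ht ↦ ⟨?_, hlow t ht⟩⟩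
  rw [(hx1 t ht).deriv]
  exact hnull t ht

omit [IsManifold (𝓡 4) ∞ M] in
lemma _root_.IsCurve.isReparametrization_self {S : Set ℝ} {γ : ℝ → M} (hγ : IsCurve S γ) :
    IsReparametrization S γ S γ := by
  refine ⟨id, ⟨univ, isOpen_univ, ordConnected_univ, subset_univ _, id, contMDiffOn_id,
    fun _ _ ↦ rfl⟩, image_id S, fun s hs ↦ ?_, fun _ _ ↦ rfl⟩
  rw [derivWithin_id _ _ (hγ.1.uniqueDiffOn s hs)]
  exact one_pos

/-- The `g`-geodesic with initial velocity `v` has a reparametrization that is null for `h`. Its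
velocity at the point in question is a positive multiple of `v`, so `v` is `h`-null; that it is an
`h`-geodesic plays no role. -/
lemma null_vector_of_null_geodesic
    (H : ∀ (S : Set ℝ) (γ : ℝ → M), IsCurve S γ →
      g.IsNullGeodesicUpToReparametrization S γ → h.IsNullGeodesicUpToReparametrization S γ)
    (p : M) (v : TangentSpace (𝓡 4) p) (hv : g.form p v v = 0) : h.form p v v = 0 := by
  set φ := chartAt R4 p
  have hφ : φ ∈ IsManifold.maximalAtlas (𝓡 4) ∞ M := IsManifold.chart_mem_maximalAtlas p
  have hp : p ∈ φ.source := mem_chart_source R4 p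
  let w : R4 := mfderiv (𝓡 4) (𝓡 4) φ p v
  have hw (k : LorentzMetric M) : k.chartForm φ (φ p) w w = k.form p v v :=
    k.chartForm_mfderiv hφ hp v v
  obtain ⟨ε, hε, x, hx0, hxw, hmem, hx, hgeo⟩ := g.exists_null_geodesic_chart hφ
    (φ.map_source hp) (by rw [hw, hv])
  set S := Ioo (-ε) ε
  have hSo : IsOpen S := isOpen_Ioo
  have h0 : (0 : ℝ) ∈ S := by simpa [S] using hε
  have hS : IsInterval S := isInterval_Ioo (by linarith)
  have hF := contMDiffOn_chart_symm_comp hφ hx hmem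
  have hcurve : IsCurve S (φ.symm ∘ x) :=
    ⟨hS, S, isOpen_Ioo, ordConnected_Ioo, subset_rfl, _, hF, fun _ _ ↦ rfl⟩
  have hde {t} (ht : t ∈ S) := chart_comp_symm_comp_eventuallyEq hSo hmem ht
  have hnull : g.IsNull S (φ.symm ∘ x) := fun t ht ↦ by
    rw [g.form_tangentVector hφ hS hSo subset_rfl hF (fun _ _ ↦ rfl) ht (φ.map_target (hmem ht)),
      (hde ht).deriv_eq, Function.comp_apply, φ.right_inv (hmem ht)]
    exact (hgeo t ht).1
  have hgeod : g.IsGeodesic S (φ.symm ∘ x) := by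
    refine g.isGeodesic_of_lowAcc hS hSo subset_rfl hF (fun _ _ ↦ rfl) fun t ht ↦
      ⟨φ, hφ, φ.map_target (hmem ht), ?_⟩
    rw [(hde ht).deriv_eq, (hde ht).deriv.deriv_eq, Function.comp_apply, φ.right_inv (hmem ht)]
    exact (hgeo t ht).2
  obtain ⟨S', γ', ⟨hS', J', hJ', -, hSJ', F', hF', hFγ'⟩, ⟨τ, -, hτS, hτ, hγτ⟩, hnull', -⟩ :=
    H S _ hcurve ⟨S, _, hcurve, hcurve.isReparametrization_self, hnull, hgeod⟩
  obtain ⟨s, hs, hs0⟩ : (0 : ℝ) ∈ τ '' S' := hτS ▸ h0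
  have hFs : F' s = p := by
    rw [hFγ' hs, hγτ s hs, hs0, Function.comp_apply, hx0, φ.left_inv hp]
  have hFsφ : F' s ∈ φ.source := by rwa [hFs]
  have hn := hnull' s hs
  rw [h.form_tangentVector hφ hS' hJ' hSJ' hF' hFγ' hs hFsφ, hFs] at hn
  have hud := hS'.uniqueDiffOn s hs
  have hd1 : HasDerivWithinAt (φ ∘ F') (deriv (φ ∘ F') s) S' s :=
    ((contDiffAt_chart_curve hφ hJ' hF' (hSJ' hs) hFsφ).differentiableAt
      (by simp)).hasDerivAt.hasDerivWithinAt
  have hd2 : HasDerivWithinAt (φ ∘ F') (derivWithin τ S' s • w) S' s := by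
    have hτd : HasDerivWithinAt τ (derivWithin τ S' s) S' s :=
      -- `derivWithin` is 0 by default where the map is not differentiable, so a positive value
      -- already gives differentiability.
      (differentiableWithinAt_of_derivWithin_ne_zero (hτ s hs).ne').hasDerivWithinAt
    have hxd : HasDerivAt x w (τ s) := by
      rw [hs0, ← hxw]
      exact ((hx.contDiffAt (hSo.mem_nhds h0)).differentiableAt (by simp)).hasDerivAt
    have hpt {t} (ht : t ∈ S') : (φ ∘ F') t = (x ∘ τ) t := by
      have : τ t ∈ S := hτS ▸ mem_image_of_mem τ ht
      rw [Function.comp_apply, hFγ' ht, hγτ t ht, Function.comp_apply, φ.right_inv (hmem this)]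
      rfl
    exact (hxd.scomp_hasDerivWithinAt s hτd).congr (fun t ht ↦ hpt ht) (hpt hs)
  rw [hud.eq_deriv _ hd1 hd2] at hn
  simp only [map_smul, smul_apply, smul_eq_mul, hw] at hn
  simpa [(hτ s hs).ne'] using hn

/-- Pointwise proportional metrics are conformally equivalent: the factor is smooth. -/
lemma isConformallyEquivalent_of_pointwise
    (H : ∀ p, ∃ c : ℝ, 0 < c ∧ ∀ u v : TangentSpace (𝓡 4) p, h.form p u v = c * g.form p u v) :
    h.IsConformallyEquivalent g := by
  choose c hc hform using H
  refine ⟨fun p ↦ √(c p), fun p ↦ ?_, fun p u v ↦ by rw [Real.sq_sqrt (hc p).le, hform]⟩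
  set φ := chartAt R4 p
  have hφ : φ ∈ IsManifold.maximalAtlas (𝓡 4) ∞ M := IsManifold.chart_mem_maximalAtlas p
  have hp : p ∈ φ.source := mem_chart_source R4 p
  have hy : φ p ∈ φ.target := φ.map_source hp
  obtain ⟨ξ, hξ⟩ := g.exists_isLorentzBasis_chartForm hφ hy
  have hξ0 : g.chartForm φ (φ p) (ξ 0) (ξ 0) ≠ 0 := by simp [hξ 0 0]
  have hsm (k : LorentzMetric M) :
      ContDiffAt ℝ ∞ (fun y ↦ k.chartForm φ y (ξ 0) (ξ 0)) (φ p) :=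
    (((k.contDiffOn_chartForm hφ).clm_apply contDiffOn_const).clm_apply
      contDiffOn_const).contDiffAt (φ.open_target.mem_nhds hy)
  -- The constant coordinate vector `ξ 0` is non-null at `φ p`, hence nearby, and there the factor
  -- is this quotient of smooth functions.
  set r : R4 → ℝ := fun y ↦ h.chartForm φ y (ξ 0) (ξ 0) / g.chartForm φ y (ξ 0) (ξ 0)
  have hr : ContDiffAt ℝ ∞ r (φ p) := (hsm h).div (hsm g) hξ0
  have hval {q : M} (hq : q ∈ φ.source) (hne : g.chartForm φ (φ q) (ξ 0) (ξ 0) ≠ 0) :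
      r (φ q) = c q := by
    have : h.chartForm φ (φ q) (ξ 0) (ξ 0) = c q * g.chartForm φ (φ q) (ξ 0) (ξ 0) := by
      rw [chartForm_apply, chartForm_apply, hform, φ.left_inv hq]
    simp only [r]
    rw [this, mul_div_cancel_right₀ _ hne]
  have hrpos : r (φ p) ≠ 0 := by rw [hval hp hξ0]; exact (hc p).ne'
  have hcomp : ContMDiffAt (𝓡 4) 𝓘(ℝ, ℝ) ∞ ((fun y ↦ √(r y)) ∘ φ) p :=
    (hr.sqrt hrpos).contMDiffAt.comp p (contMDiffAt_of_mem_maximalAtlas hφ hp)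
  refine hcomp.congr_of_eventuallyEq ?_
  filter_upwards [φ.open_source.mem_nhds hp, (φ.continuousAt hp).eventually
    ((hsm g).continuousAt.eventually_ne hξ0)] with q hq hne
  rw [Function.comp_apply, hval hq hne]

lemma isConformallyEquivalent_of_null
    (H : ∀ (p : M) (v : TangentSpace (𝓡 4) p), g.form p v v = 0 → h.form p v v = 0) :
    h.IsConformallyEquivalent g := by
  refine g.isConformallyEquivalent_of_pointwise h fun p ↦ ?_
  obtain ⟨ξ, hξ⟩ := g.signature p
  obtain ⟨η, hη⟩ := h.signature p
  have hB : IsLorentzBasis (g.form p) ξ := hξ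
  have hC : IsLorentzBasis (h.form p) η := hη
  have hmul := hB.eq_mul_of_null (h.symm p) (H p)
  exact ⟨_, hB.factor_pos hC hmul, hmul⟩

lemma isConformallyEquivalent_of_timelike
    (H : ∀ (S : Set ℝ) (γ : ℝ → M), IsCurve S γ → (h.IsTimelike S γ ↔ g.IsTimelike S γ)) :
    h.IsConformallyEquivalent g := by
  refine g.isConformallyEquivalent_of_null h fun p ↦ ?_
  obtain ⟨ξ, hξ⟩ := g.signature p
  have hB : IsLorentzBasis (g.form p) ξ := hξ
  exact hB.null_of_timelike_iff fun v ↦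
    ⟨h.timelike_vector_of_timelike_curve g (fun S γ hγ ↦ (H S γ hγ).1) p v,
      g.timelike_vector_of_timelike_curve h (fun S γ hγ ↦ (H S γ hγ).2) p v⟩

end LorentzMetric

end PointwiseConsequences

/-! ### Conformal invariance of null geodesics up to parameter. -/

section ConformalChange

lemma fderiv_apply_of_eventually_eq_smul {E F : Type*} [NormedAddCommGroup E] [NormedSpace ℝ E]
    [NormedAddCommGroup F] [NormedSpace ℝ F] {G H : E → F} {μ : E → ℝ} {y : E}
    (hH : ∀ᶠ z in nhds y, H z = μ z • G z)
    (hG : DifferentiableAt ℝ G y) (hμ : DifferentiableAt ℝ μ y) (v : E) :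
    fderiv ℝ H y v = μ y • fderiv ℝ G y v + fderiv ℝ μ y v • G y := by
  rw [Filter.EventuallyEq.fderiv_eq hH, fderiv_fun_smul hμ hG]
  rfl

-- By the product rule. When `v` is null the last term drops out, leaving an extra term along G(v,
-- ·) that a change of parameter can absorb.
set_option synthInstance.maxHeartbeats 100000 in
lemma lowAcc_smul {G H : R4 → R4 →L[ℝ] R4 →L[ℝ] ℝ} {μ : R4 → ℝ} {y : R4}
    (hG : DifferentiableAt ℝ G y) (hμ : DifferentiableAt ℝ μ y)
    (hH : ∀ᶠ z in nhds y, H z = μ z • G z) (v a w : R4) :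
    lowAcc H y v a w = μ y * lowAcc G y v a w + fderiv ℝ μ y v * G y v w -
      1 / 2 * fderiv ℝ μ y w * G y v v := by
  have hd (v : R4) := fderiv_apply_of_eventually_eq_smul (F := R4 →L[ℝ] R4 →L[ℝ] ℝ)
    (G := G) (H := H) (μ := μ) (y := y) hH hG hμ v
  simp only [lowAcc, hd, hH.self_of_nhds, add_apply, smul_apply, smul_eq_mul]
  ring

/-- The arguments are the velocity and acceleration after a parameter change σ with σ' = m and σ'' =
b. -/
lemma lowAcc_reparam (G : R4 → R4 →L[ℝ] R4 →L[ℝ] ℝ) (y v a w : R4) (m b : ℝ) :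
    lowAcc G y (m • v) (b • v + m ^ 2 • a) w = m ^ 2 * lowAcc G y v a w + b * G y v w := by
  simp only [lowAcc, ContinuousLinearMap.map_smul, map_add, add_apply, smul_apply, smul_eq_mul]
  ring

variable {M : Type*} [TopologicalSpace M] [ChartedSpace R4 M] [IsManifold (𝓡 4) ∞ M]

namespace LorentzMetric

variable {g h : LorentzMetric M}

/-- Conformal equivalence does not require a nowhere vanishing Ω; the vector of `h`-square 1 forces
it. -/
lemma factor_ne_zero {p : M} {c : ℝ}
    (H : ∀ u v : TangentSpace (𝓡 4) p, h.form p u v = c ^ 2 * g.form p u v) : c ≠ 0 := by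
  rintro rfl
  obtain ⟨η, hη⟩ := h.signature p
  have := hη 0 0
  rw [H] at this
  simp at this

lemma IsConformallyEquivalent.symm (H : h.IsConformallyEquivalent g) :
    g.IsConformallyEquivalent h := by
  obtain ⟨Ω, hΩ, hform⟩ := H
  have hne (p : M) : Ω p ≠ 0 := factor_ne_zero (hform p)
  refine ⟨fun p ↦ (Ω p)⁻¹, fun p ↦ ?_, fun p u v ↦ ?_⟩
  · exact (contDiffAt_inv ℝ (hne p)).contMDiffAt.comp p (hΩ p)
  · rw [hform]
    field_simp [hne p]

lemma IsConformallyEquivalent.isTimelike_iff (H : h.IsConformallyEquivalent g) (S : Set ℝ)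
    (γ : ℝ → M) : h.IsTimelike S γ ↔ g.IsTimelike S γ := by
  obtain ⟨Ω, -, hform⟩ := H
  refine forall₂_congr fun s _ ↦ ?_
  rw [hform]
  exact mul_pos_iff_of_pos_left (sq_pos_of_ne_zero (factor_ne_zero (hform _)))

/-- Along an `h`-null geodesic with velocity v, put m = Ω². The `h`-equation reads m · lowAcc_g + m'
g(v, ·) = 0. If σ' = m ∘ σ then σ'' = m m', and the new lowered `g`-acceleration is m² · lowAcc_g +
m m' g(v, ·), which is m times the left side. -/
lemma IsConformallyEquivalent.isNullGeodesicUpToReparametrization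
    (H : h.IsConformallyEquivalent g) {S : Set ℝ} {γ : ℝ → M}
    (hγ : h.IsNullGeodesicUpToReparametrization S γ) :
    g.IsNullGeodesicUpToReparametrization S γ := by
  obtain ⟨Ω, hΩ, hform⟩ := H
  have hne (p : M) : Ω p ≠ 0 := factor_ne_zero (hform p)
  obtain ⟨S', γ', ⟨hS', J₁, hJ₁, hJ₁c, hSJ₁, F, hF, hFγ⟩,
    ⟨τ, ⟨J₂, hJ₂, hJ₂c, hSJ₂, T, hT, hTτ⟩, hτS, hτ, hγτ⟩, hnull, hgeo⟩ := hγ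
  set J := J₁ ∩ J₂
  have hJ : IsOpen J := hJ₁.inter hJ₂
  have hSJ : S' ⊆ J := subset_inter hSJ₁ hSJ₂
  have hF' : ContMDiffOn 𝓘(ℝ, ℝ) (𝓡 4) ∞ F J := hF.mono inter_subset_left
  set m : ℝ → ℝ := fun s ↦ Ω (F s) ^ 2
  have hm : ContDiffOn ℝ ∞ m J := (contMDiffOn_iff_contDiffOn.1 (hΩ.comp_contMDiffOn hF')).pow 2
  have hmpos (s : ℝ) : 0 < m s := by have := hne (F s); positivity
  obtain ⟨K, σ, hK, hKc, hbij, hmono, hσ, hσs⟩ :=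
    exists_autonomous_reparam hJ (hJ₁c.inter hJ₂c) hm fun s _ ↦ hmpos s
  -- `σ` runs over all of `J`, so this preimage maps onto `S'`; monotonicity of `σ` makes it an
  -- interval.
  set S'' := K ∩ σ ⁻¹' S'
  have hS''K : S'' ⊆ K := inter_subset_left
  have himage : σ '' S'' = S' := by
    refine Subset.antisymm (by rintro _ ⟨t, ht, rfl⟩; exact ht.2) fun s hs ↦ ?_
    obtain ⟨t, ht, rfl⟩ := hbij.surjOn (hSJ hs)
    exact ⟨t, ⟨ht, hs⟩, rfl⟩
  have hS'' : IsInterval S'' := by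
    refine ⟨⟨fun a ha b hb t ht ↦ ?_⟩, Set.nontrivial_of_image σ S'' (himage.symm ▸ hS'.2)⟩
    have htK := hKc.out ha.1 hb.1 ht
    exact ⟨htK, hS'.1.out ha.2 hb.2
      ⟨hmono.monotoneOn ha.1 htK ht.1, hmono.monotoneOn htK hb.1 ht.2⟩⟩
  have hFσ : ContMDiffOn 𝓘(ℝ, ℝ) (𝓡 4) ∞ (F ∘ σ) K := hF'.comp hσs.contMDiffOn hbij.mapsTo
  have hFσγ : EqOn (F ∘ σ) (γ' ∘ σ) S'' := fun t ht ↦ hFγ ht.2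
  have hpoint (t) (ht : t ∈ S'') : ∃ φ ∈ IsManifold.maximalAtlas (𝓡 4) ∞ M,
      F (σ t) ∈ φ.source ∧
      g.chartForm φ (φ (F (σ t))) (deriv (φ ∘ F ∘ σ) t) (deriv (φ ∘ F ∘ σ) t) = 0 ∧
      ∀ w, lowAcc (g.chartForm φ) (φ (F (σ t))) (deriv (φ ∘ F ∘ σ) t)
        (deriv (deriv (φ ∘ F ∘ σ)) t) w = 0 := by
    set s := σ t
    have hsJ : s ∈ J := hbij.mapsTo ht.1
    set φ := chartAt R4 (F s)
    have hφ : φ ∈ IsManifold.maximalAtlas (𝓡 4) ∞ M := IsManifold.chart_mem_maximalAtlas _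
    have hp : F s ∈ φ.source := mem_chart_source R4 _
    have hy : φ (F s) ∈ φ.target := φ.map_source hp
    have hFc : ContinuousAt F s := (hF'.contMDiffAt (hJ.mem_nhds hsJ)).continuousAt
    have hx := contDiffAt_chart_curve hφ hJ hF' hsJ hp
    set x := φ ∘ F with hx_def
    set μ : R4 → ℝ := fun y ↦ Ω (φ.symm y) ^ 2
    have hμ : DifferentiableAt ℝ μ (φ (F s)) := by
      have : ContMDiffAt (𝓡 4) 𝓘(ℝ, ℝ) ∞ (Ω ∘ φ.symm) (φ (F s)) :=
        hΩ.contMDiffAt.comp _ (contMDiffAt_symm_of_mem_maximalAtlas hφ hy)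
      exact (contMDiffAt_iff_contDiffAt.1 this).differentiableAt (by simp) |>.pow 2
    have hforms (z : R4) : h.chartForm φ z = μ z • g.chartForm φ z := by
      ext u v
      simp only [chartForm_apply, hform, smul_apply, smul_eq_mul, μ]
    have hμs : μ (φ (F s)) = m s := by simp only [μ, m, φ.left_inv hp]
    have hms : HasDerivAt m (fderiv ℝ μ (φ (F s)) (deriv x s)) s := by
      refine (DifferentiableAt.hasDerivAt_comp_curve (H := μ) (f := x) hμ
        (hx.differentiableAt (by simp)).hasDerivAt).congr_of_eventuallyEq ?_
      filter_upwards [hFc.preimage_mem_nhds (φ.open_source.mem_nhds hp)] with r hr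
      simp only [μ, m, x, Function.comp_apply, φ.left_inv hr]
    have hn := hnull s ht.2
    rw [h.form_tangentVector hφ hS' hJ hSJ hF' hFγ ht.2 hp, hforms, smul_apply, smul_apply,
      smul_eq_mul, hμs, mul_eq_zero, or_iff_right (hmpos s).ne'] at hn
    have ha := (h.acceleration_eq_zero_iff hφ hS' hJ hSJ hF' hFγ ht.2 hp).1
      (hgeo s ht.2 φ hφ (hFγ ht.2 ▸ hp))
    have hd1 : deriv (x ∘ σ) =ᶠ[nhds t] fun r ↦ m (σ r) • deriv x (σ r) := by
      filter_upwards [hK.mem_nhds ht.1, (hσ t ht.1).continuousAt.eventually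
        (hx.two_of_infty.eventually (by simp))] with r hr hr'
      exact ((hr'.differentiableAt (by simp)).hasDerivAt.scomp r (hσ r hr)).deriv
    -- The coefficient of the velocity is σ'' = m' m, the choice of `b` in `lowAcc_reparam`.
    have hd2 : deriv (deriv (x ∘ σ)) t =
        (fderiv ℝ μ (φ (F s)) (deriv x s) * m s) • deriv x s + m s ^ 2 • deriv (deriv x) s := by
      rw [hd1.deriv_eq]
      have h1 : HasDerivAt (fun r ↦ m (σ r)) (fderiv ℝ μ (φ (F s)) (deriv x s) * m s) t :=
        hms.comp t (hσ t ht.1)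
      have h2 : HasDerivAt (fun r ↦ deriv x (σ r)) (m s • deriv (deriv x) s) t :=
        hx.two_of_infty.differentiableAt_deriv.hasDerivAt.scomp t (hσ t ht.1)
      rw [(h1.fun_smul h2).deriv, smul_smul, add_comm, sq]
    refine ⟨φ, hφ, hp, ?_⟩
    rw [← Function.comp_assoc, ← hx_def, hd2, hd1.self_of_nhds]
    have hn' : g.chartForm φ (φ (F s)) (deriv x s) (deriv x s) = 0 := hn
    change g.chartForm φ (φ (F s)) (m s • deriv x s) (m s • deriv x s) = 0 ∧
      ∀ w, lowAcc (g.chartForm φ) (φ (F s)) (m s • deriv x s) _ w = 0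
    refine ⟨by simp [hn'], fun w ↦ ?_⟩
    have hw := ha w
    rw [lowAcc_smul (g.differentiableAt_chartForm hφ hy) hμ (Filter.Eventually.of_forall hforms),
      hμs, hn] at hw
    rw [lowAcc_reparam]
    linear_combination m s * hw
  refine ⟨S'', γ' ∘ σ, ⟨hS'', K, hK, hKc, hS''K, F ∘ σ, hFσ, hFσγ⟩,
    ⟨τ ∘ σ, ⟨K, hK, hKc, hS''K, T ∘ σ, ?_, fun t ht ↦ hTτ ht.2⟩, ?_, fun t ht ↦ ?_,
      fun t ht ↦ hγτ _ ht.2⟩, fun t ht ↦ ?_, ?_⟩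
  · exact (hT.mono inter_subset_right).comp hσs.contMDiffOn hbij.mapsTo
  · rw [image_comp, himage, hτS]
  · have hτd : HasDerivWithinAt τ (derivWithin τ S' (σ t)) S' (σ t) :=
      (differentiableWithinAt_of_derivWithin_ne_zero (hτ _ ht.2).ne').hasDerivWithinAt
    rw [(hτd.comp t (hσ t ht.1).hasDerivWithinAt fun r hr ↦ hr.2).derivWithin
      (hS''.uniqueDiffOn t ht)]
    exact mul_pos (hτ _ ht.2) (hmpos _)
  · obtain ⟨φ, hφ, hp, hn, -⟩ := hpoint t ht
    rw [g.form_tangentVector hφ hS'' hK hS''K hFσ hFσγ ht hp]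
    exact hn
  · refine g.isGeodesic_of_lowAcc hS'' hK hS''K hFσ hFσγ fun t ht ↦ ?_
    obtain ⟨φ, hφ, hp, -, ha⟩ := hpoint t ht
    exact ⟨φ, hφ, hp, ha⟩

end LorentzMetric

end ConformalChange

end

theorem mainTheorem8 {M : Type*} [TopologicalSpace M] [T2Space M] [ConnectedSpace M]
    [ChartedSpace R4 M] [IsManifold (𝓡 4) ∞ M] (g h : LorentzMetric M) :
    List.TFAE [
      ∀ (S : Set ℝ) (γ : ℝ → M), IsCurve S γ → (h.IsTimelike S γ ↔ g.IsTimelike S γ),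
      ∀ (S : Set ℝ) (γ : ℝ → M), IsCurve S γ →
        (h.IsNullGeodesicUpToReparametrization S γ ↔ g.IsNullGeodesicUpToReparametrization S γ),
      h.IsConformallyEquivalent g] := by
  tfae_have 1 → 3 := g.isConformallyEquivalent_of_timelike h
  tfae_have 2 → 3 := fun H ↦ g.isConformallyEquivalent_of_null h
    (g.null_vector_of_null_geodesic h fun S γ hγ ↦ (H S γ hγ).2)
  tfae_have 3 → 1 := fun H S γ _ ↦ H.isTimelike_iff S γ
  tfae_have 3 → 2 := fun H S γ _ ↦
    ⟨H.isNullGeodesicUpToReparametrization, H.symm.isNullGeodesicUpToReparametrization⟩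
  tfae_finish
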